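/- Let $h>\kappa>0$, put $\xi=\frac h\kappa-1$, and let $V_{\mathrm{Kep}}(x)=-1/|x|$ on $\mathbb R^2\setminus\{0\}$. Call a smooth Riemannian metric $g$ on $\mathbb R^2$ that is invariant under rotations about the origin *admissible* if the system $(g,V_{\mathrm{Kep}})$ with energy $H=\frac12 g(\dot x,\dot x)+V_{\mathrm{Kep}}(x)$ is Zoll on both $\{H=-\frac\kappa2\}$ and $\{H=-\frac h2\}$; here Zoll on $\{H=e\}$ means that all non-collision orbits of energy $e$ (those that do not run into the origin in finite time) are closed and have the same length in the Jacobi–Maupertuis metric $2(e-V_{\mathrm{Kep}})g$. Call two metrics equivalent if they agree on the Hill regions of these energies, that is, on $\{0<|x|\le \frac 2\kappa\}$. Then: 1. The space of admissible metrics up to equivalence is infinite dimensional: for every $n$ there is a smooth $n$-parameter family $(g_s)_{s\in\mathbb R^n}$ of pairwise non-equivalent admissible metrics that is an immersion (every nonzero variation of $s$ changes $g_s$ to first order somewhere on the Hill regions). 2. The space $\mathscr C^\infty_{\mathrm c}((0,1))$ of smooth functions with compact support in $(0,1)$ embeds in this space. Precisely, there are $-\xi\le a<b\le 0$ and $\delta>0$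 and a map $f\mapsto g_f$ from $\mathscr C^\infty_{\mathrm c}((0,1))$ to the admissible metrics such that $g_f$ and $g_{f'}$ are non-equivalent for $f\ne f'$, and such that on $\{0<|x|\le\frac2\kappa\}$, in polar coordinates $(\rho,\theta)$, $$g_f=\Big(1+\frac{\tilde f(1-h\rho)}{2-h\rho}\Big)^2 d\rho^2+\rho^2\,d\theta^2$$ with positive radial factor $1+\frac{\tilde f(1-h\rho)}{2-h\rho}$ (the quotient at $\rho=\frac2h$ being understood as a limit), where the deformation function $\tilde f\in\mathscr C^\infty(\mathbb R)$ satisfies $\tilde f(a+(b-a)s)=\delta\, f(s)/\sqrt{1+f(s)^2}$ for $s\in(0,1)$, vanishes on $[-\xi,0]\setminus(a,b)$, and is extended by the reflection laws $\tilde f(-x)=-\tilde f(x)$ for $x\in[-1,1]$ and $$(1-x^2)\,\tilde f(-2\xi-x)=-\big(1-(2\xi+x)^2\big)\,\tilde f(x),\qquad x\in[-1-2\xi,1].$$ -/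

import Mathlib

open scoped ContDiff

noncomputable section

namespace Kepler

/-- The Euclidean plane. -/
abbrev Plane : Type := EuclideanSpace ℝ (Fin 2)

/-- A smooth Riemannian metric on the whole plane that is invariant under all rotations about
the origin, written as a smooth field of inner products on tangent vectors. -/
structure RotMetric where
  /-- The inner product at a point. -/
  inner : Plane → Plane →L[ℝ] Plane →L[ℝ] ℝ
  smooth : ContDiff ℝ ∞ inner
  symm : ∀ x u w, inner x u w = inner x w u
  pos : ∀ x u, u ≠ 0 → 0 < inner x u u
  /-- Invariance under the special orthogonal group of the plane. -/
  rot : ∀ R : Plane ≃ₗᵢ[ℝ] Plane, LinearMap.det (R.toLinearEquiv : Plane →ₗ[ℝ] Plane) = 1 →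
    ∀ x u w, inner (R x) (R u) (R w) = inner x u w

/-- The Kepler potential (only ever used away from the origin). -/
def keplerPotential (x : Plane) : ℝ := -(1 / ‖x‖)

/-- The natural Lagrangian of the system `(g, V)`, at the point `x` and the velocity `u`. -/
def lagrangian (g : RotMetric) (V : Plane → ℝ) (x u : Plane) : ℝ :=
  1 / 2 * g.inner x u u - V x

/-- The Hamiltonian of the system `(g, V)`, read on velocities through the Legendre transform. -/
def energy (g : RotMetric) (V : Plane → ℝ) (x u : Plane) : ℝ :=
  1 / 2 * g.inner x u u + V x

/-- On the time set `I` (always an open interval below), the curve `γ` avoids the origin, has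
velocity `v`, and solves the Euler-Lagrange equation
`d/dt (∂L/∂u) = ∂L/∂x` of the Lagrangian `L`. -/
def IsMotion (L : Plane → Plane → ℝ) (γ v : ℝ → Plane) (I : Set ℝ) : Prop :=
  ∀ t ∈ I, γ t ≠ 0 ∧ HasDerivAt γ (v t) t ∧
    ∀ w : Plane, HasDerivAt (fun τ => fderiv ℝ (fun u => L (γ τ) u) (v τ) w)
      (fderiv ℝ (fun y => L y (v t)) (γ t) w) t

/-- The orbit with position `q` and velocity `u` at time `0` is a collision orbit: in finite
time, in the future or in the past, it runs into the origin. -/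
def IsCollisionState (L : Plane → Plane → ℝ) (q u : Plane) : Prop :=
  ∃ (γ v : ℝ → Plane) (a b : ℝ), a < 0 ∧ 0 < b ∧ IsMotion L γ v (Set.Ioo a b) ∧
    γ 0 = q ∧ v 0 = u ∧
    (Filter.Tendsto γ (nhdsWithin a (Set.Ioi a)) (nhds 0) ∨
      Filter.Tendsto γ (nhdsWithin b (Set.Iio b)) (nhds 0))

/-- The length of the curve `γ` with velocity `v` over the time interval `[0, T]`, for the
Jacobi-Maupertuis metric `2 (e - V) g` of the system `(g, V)` at energy `e`. -/
def jacobiLength (g : RotMetric) (V : Plane → ℝ) (e : ℝ) (γ v : ℝ → Plane) (T : ℝ) : ℝ :=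
  ∫ t in (0 : ℝ)..T, Real.sqrt (2 * (e - V (γ t)) * g.inner (γ t) (v t) (v t))

/-- The orbit with position `q` and velocity `u` at time `0` is defined for all times and
periodic, and has Jacobi-Maupertuis length `l` over its minimal period. -/
def IsClosedState (g : RotMetric) (V : Plane → ℝ) (e l : ℝ) (q u : Plane) : Prop :=
  ∃ (γ v : ℝ → Plane) (T : ℝ), IsMotion (lagrangian g V) γ v Set.univ ∧
    γ 0 = q ∧ v 0 = u ∧
    0 < T ∧ Function.Periodic γ T ∧ (∀ T' : ℝ, 0 < T' → Function.Periodic γ T' → T ≤ T') ∧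
    jacobiLength g V e γ v T = l

/-- The system `(g, V)`, with `V` smooth away from the origin, is Zoll on `{H = e}`: all
non-collision orbits of energy `e` are closed, and all of them have the same length. -/
def IsZoll (g : RotMetric) (V : Plane → ℝ) (e : ℝ) : Prop :=
  ∃ l : ℝ, ∀ q u : Plane, q ≠ 0 → energy g V q u = e →
    ¬ IsCollisionState (lagrangian g V) q u → IsClosedState g V e l q u

/-- The Hill region: the projection of the energy shell `{H = e}` to the punctured plane. -/
def hillRegion (V : Plane → ℝ) (e : ℝ) : Set Plane := {x | x ≠ 0 ∧ V x ≤ e}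

/-- Two metrics are equivalent over `D` if they agree on `D`. -/
def EquivOn (D : Set Plane) (g g' : RotMetric) : Prop := ∀ x ∈ D, g.inner x = g'.inner x

/-- The set `S` of metrics, taken modulo equivalence over `D`, is infinite dimensional: for every
`n` it contains a smooth `n`-parameter family of pairwise non-equivalent metrics, which is
moreover an immersion (a nonzero variation of the parameters changes the metric on `D` to first
order). -/
def InfiniteDimensional (S : Set RotMetric) (D : Set Plane) : Prop :=
  ∀ n : ℕ, ∃ G : EuclideanSpace ℝ (Fin n) → RotMetric,
    (∀ s, G s ∈ S) ∧
    (∀ s s', EquivOn D (G s) (G s') → s = s') ∧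
    ContDiff ℝ ∞ (fun p : EuclideanSpace ℝ (Fin n) × Plane => (G p.1).inner p.2) ∧
    ∀ s c, c ≠ 0 → ∃ x ∈ D, fderiv ℝ (fun s' => (G s').inner x) s c ≠ 0

/-- The rotationally invariant metrics which, together with the Kepler potential, are Zoll on
`{H = -κ/2}` and on `{H = -h/2}`. -/
def zollMetrics (h κ : ℝ) : Set RotMetric :=
  {g | IsZoll g keplerPotential (-κ / 2) ∧ IsZoll g keplerPotential (-h / 2)}

/-- The union of the two Hill regions; equivalence of metrics means agreement on it. -/
def hillUnion (h κ : ℝ) : Set Plane :=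
  hillRegion keplerPotential (-κ / 2) ∪ hillRegion keplerPotential (-h / 2)

/-- The one-form `dρ` of polar coordinates. -/
def dRho (x u : Plane) : ℝ := (x 0 * u 0 + x 1 * u 1) / ‖x‖

/-- The one-form `dθ` of polar coordinates. -/
def dTheta (x u : Plane) : ℝ := (x 0 * u 1 - x 1 * u 0) / ‖x‖ ^ 2

/-- The metric `g` has deformation function `F`: on the Hill regions,
`g = (1 + F (1 - h ρ) / (2 - h ρ))² dρ² + ρ² dθ²`. The radial factor `A` is positive, and the
quotient is written without division, so that its value at `ρ = 2 / h` is the limit. -/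
def HasDeformationFunction (h κ : ℝ) (g : RotMetric) (F : ℝ → ℝ) : Prop :=
  ∃ A : ℝ → ℝ, (∀ ρ, 0 < ρ → ρ ≤ 2 / κ → 0 < A ρ ∧
      (2 - h * ρ) * (A ρ - 1) = F (1 - h * ρ)) ∧
    ∀ x ∈ hillUnion h κ, ∀ u w : Plane,
      g.inner x u w = A ‖x‖ ^ 2 * (dRho x u * dRho x w) + ‖x‖ ^ 2 * (dTheta x u * dTheta x w)

/-- The reflection laws, with `ξ = h/κ - 1`: on `[-1, 1]` the function `F` is odd, and on
`[-1 - 2 ξ, 1]` the function `F x / (1 - x²)` is odd with respect to the reflection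
`x ↦ -2 ξ - x` about `-ξ` (written without division). -/
def ReflectionLaws (ξ : ℝ) (F : ℝ → ℝ) : Prop :=
  (∀ x ∈ Set.Icc (-1 : ℝ) 1, F (-x) = -F x) ∧
  ∀ x ∈ Set.Icc (-1 - 2 * ξ) 1,
    (1 - x ^ 2) * F (-2 * ξ - x) = -((1 - (-2 * ξ - x) ^ 2) * F x)

/-- The smooth functions on the line with compact support in the open interval `(0, 1)`. -/
abbrev BumpSpace : Type :=
  TestFunction (⟨Set.Ioo (0 : ℝ) 1, isOpen_Ioo⟩ : TopologicalSpace.Opens ℝ) ℝ ⊤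

end Kepler

end

noncomputable section

namespace Kepler

/-! Write the metric as A(ρ)² dρ² + ρ² dθ² and parametrize an orbit of energy -k/2 and angular
momentum ℓ by an eccentric anomaly: kρ = 1 - r cos φ with r² = 1 - kℓ². Conservation of energy then
gives dt/dφ = Aρ/√k, whatever A is. If A = 1 + (1 - y) f(y) with y = 1 - kρ = r cos φ, then over one
turn of φ the deformation adds to the swept angle a multiple of ∫ f(r cos φ) and to the Jacobi
length a multiple of ∫ (1 - y²) f(y). Both vanish when f is odd. So every orbit with ℓ ≠ 0 closes
after one turn, with length 2π/√k (`orbit_angle_period`, `orbit_length`, `isClosedState_orbit`),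
while orbits with ℓ = 0 collide (`isCollisionState_radial`). This gives the criterion
`isZoll_of_odd`.

For two energies use x = 1 - hρ and A = 1 + hρ G(x). The criterion asks that G be odd about 0
(energy -h/2) and odd about -ξ (energy -κ/2). The two reflections have the fundamental domain [-ξ,
0], so any function supported inside it extends to an odd 2ξ-periodic G (`Window.oddPart`). The
origin of the plane sits at x = 1. The support is chosen so that none of its images contains 1,
which makes the metric Euclidean near the origin. A small amplitude and a cutoff beyond the Hill
regions keep A positive. The metric at a suitable radius returns the value of the profile, whence
injectivity (`Window.profile_eq_of_equivOn`) and the immersion property. -/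

lemma contDiff_smul_real {E W : Type*} [NormedAddCommGroup E] [NormedSpace ℝ E]
    [NormedAddCommGroup W] [NormedSpace ℝ W] {f : E → ℝ} {g : E → W}
    (hf : ContDiff ℝ ∞ f) (hg : ContDiff ℝ ∞ g) : ContDiff ℝ ∞ (fun x => f x • g x) :=
  hf.smul hg

lemma contDiff_add_smul_smulRight {E V : Type*} [NormedAddCommGroup E] [NormedSpace ℝ E]
    [NormedAddCommGroup V] [NormedSpace ℝ V] (p : V →L[ℝ] V →L[ℝ] ℝ) {f : E → ℝ}
    (hf : ContDiff ℝ ∞ f) {q : E → V} (hq : ContDiff ℝ ∞ q) :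
    ContDiff ℝ ∞ (fun x => p + f x • (p (q x)).smulRight (p (q x))) := by
  have h1 : ContDiff ℝ ∞ (fun x => (p (q x)).smulRight (p (q x))) :=
    (p.contDiff.comp hq).smulRight (p.contDiff.comp hq)
  exact contDiff_const.add (contDiff_smul_real hf h1)

/-! ### Radial metrics and the derivatives of their Lagrangian -/

/-- The Euclidean inner product of the plane as a bilinear map. -/
def planeInner : Plane →L[ℝ] Plane →L[ℝ] ℝ := innerSL ℝ

lemma planeInner_apply (u w : Plane) : planeInner u w = inner ℝ u w := rfl

/-- The rotationally invariant metric `⟨u, w⟩ + β(|x|²) ⟨x, u⟩ ⟨x, w⟩`. -/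
def radialMetric (β : ℝ → ℝ) (hβ : ContDiff ℝ ∞ β) (hpos : ∀ s, 0 ≤ s → 0 < 1 + s * β s) :
    RotMetric where
  inner x := planeInner + β (‖x‖ ^ 2) • (planeInner x).smulRight (planeInner x)
  smooth := contDiff_add_smul_smulRight planeInner (hβ.comp (contDiff_norm_sq ℝ)) contDiff_id
  symm x u w := by
    simp [planeInner_apply, real_inner_comm u w, mul_comm]
  pos x u hu := by
    have hu' : 0 < ‖u‖ ^ 2 := by positivity
    have h1 : (inner ℝ x u : ℝ) ^ 2 ≤ ‖x‖ ^ 2 * ‖u‖ ^ 2 := by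
      have := abs_real_inner_le_norm x u
      rw [← sq_abs, ← mul_pow]
      exact pow_le_pow_left₀ (abs_nonneg _) this 2
    have h2 := hpos (‖x‖ ^ 2) (by positivity)
    have h3 : 0 < ‖u‖ ^ 2 + β (‖x‖ ^ 2) * (inner ℝ x u : ℝ) ^ 2 := by
      rcases le_total 0 (β (‖x‖ ^ 2)) with hb | hb
      · positivity
      · have := mul_le_mul_of_nonpos_left h1 hb
        nlinarith [mul_pos h2 hu']
    simpa [planeInner_apply, sq] using h3
  rot R _ x u w := by simp [planeInner_apply]

section
variable {β : ℝ → ℝ} {hβ : ContDiff ℝ ∞ β} {hpos : ∀ s, 0 ≤ s → 0 < 1 + s * β s}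

lemma radialMetric_inner (x u w : Plane) :
    (radialMetric β hβ hpos).inner x u w =
      inner ℝ u w + β (‖x‖ ^ 2) * (inner ℝ x u * inner ℝ x w) := by
  simp [radialMetric, planeInner_apply]

/-- The potential is written through ‖x‖², so that the position derivative is a chain rule over the
smooth squared norm. -/
lemma lagrangian_radialMetric (x u : Plane) :
    lagrangian (radialMetric β hβ hpos) keplerPotential x u =
      1 / 2 * (‖u‖ ^ 2 + β (‖x‖ ^ 2) * (inner ℝ x u) ^ 2) + (√(‖x‖ ^ 2))⁻¹ := by
  simp [lagrangian, radialMetric_inner, keplerPotential, sq]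

lemma fderiv_velocity_lagrangian (x u w : Plane) :
    fderiv ℝ (fun u => lagrangian (radialMetric β hβ hpos) keplerPotential x u) u w =
      inner ℝ u w + β (‖x‖ ^ 2) * (inner ℝ x u * inner ℝ x w) := by
  simp only [lagrangian_radialMetric]
  have h := ((((hasStrictFDerivAt_norm_sq u).hasFDerivAt).add
    ((((innerSL ℝ x).hasFDerivAt (x := u)).pow 2).const_mul (β (‖x‖ ^ 2)))).const_mul
      (1 / 2 : ℝ)).add_const ((√(‖x‖ ^ 2))⁻¹)
  have h' := h.fderiv
  simp only [innerSL_apply_apply, Pi.add_apply] at h'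
  erw [h']
  simp
  ring

lemma fderiv_position_lagrangian {x : Plane} (hx : x ≠ 0) (u w : Plane) :
    fderiv ℝ (fun y => lagrangian (radialMetric β hβ hpos) keplerPotential y u) x w =
      deriv β (‖x‖ ^ 2) * inner ℝ x w * (inner ℝ x u) ^ 2
        + β (‖x‖ ^ 2) * (inner ℝ x u * inner ℝ u w) - inner ℝ x w / ‖x‖ ^ 3 := by
  simp only [lagrangian_radialMetric]
  have hn : 0 < ‖x‖ := norm_pos_iff.2 hx
  have hb : HasDerivAt β (deriv β (‖x‖ ^ 2)) (‖x‖ ^ 2) :=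
    (hβ.differentiable (by simp)).differentiableAt.hasDerivAt
  have hN := (hasStrictFDerivAt_norm_sq x).hasFDerivAt
  have hi : HasFDerivAt (fun y : Plane => (inner ℝ y u : ℝ)) (innerSL ℝ u) x := by
    simpa [real_inner_comm] using ((innerSL ℝ u).hasFDerivAt (x := x))
  have hs : HasDerivAt (fun s : ℝ => (√s)⁻¹) _ (‖x‖ ^ 2) :=
    (Real.hasDerivAt_sqrt (by positivity)).inv (by positivity)
  have h := (((hb.comp_hasFDerivAt x hN).mul (hi.pow 2)).const_add (‖u‖ ^ 2)).const_mul
    (1 / 2 : ℝ) |>.add (hs.comp_hasFDerivAt x hN)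
  have h' := h.fderiv
  erw [h']
  simp [Real.sqrt_sq hn.le]
  field_simp
  ring

end

/-! ### Polar coordinates and the Euler-Lagrange equation -/

/-- The radial unit vector at the polar angle `θ`. -/
def unitVec (θ : ℝ) : Plane :=
  Real.cos θ • EuclideanSpace.single 0 1 + Real.sin θ • EuclideanSpace.single 1 1

/-- The angular unit vector at the polar angle `θ`. -/
def unitPerp (θ : ℝ) : Plane :=
  -Real.sin θ • EuclideanSpace.single 0 1 + Real.cos θ • EuclideanSpace.single 1 1

lemma unitVec_zero (θ : ℝ) : unitVec θ 0 = Real.cos θ := by simp [unitVec]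
lemma unitVec_one (θ : ℝ) : unitVec θ 1 = Real.sin θ := by simp [unitVec]
lemma unitPerp_zero (θ : ℝ) : unitPerp θ 0 = -Real.sin θ := by simp [unitPerp]
lemma unitPerp_one (θ : ℝ) : unitPerp θ 1 = Real.cos θ := by simp [unitPerp]

lemma plane_inner (x y : Plane) : (inner ℝ x y : ℝ) = x 0 * y 0 + x 1 * y 1 := by
  simp [PiLp.inner_apply, Fin.sum_univ_two, mul_comm]

lemma plane_norm_sq (x : Plane) : ‖x‖ ^ 2 = x 0 ^ 2 + x 1 ^ 2 := by
  rw [← real_inner_self_eq_norm_sq, plane_inner]; ring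

lemma plane_ext {x y : Plane} (h0 : x 0 = y 0) (h1 : x 1 = y 1) : x = y := by
  ext i; fin_cases i <;> assumption

lemma inner_unitVec_self (θ : ℝ) : (inner ℝ (unitVec θ) (unitVec θ) : ℝ) = 1 := by
  rw [plane_inner, unitVec_zero, unitVec_one]; linarith [Real.sin_sq_add_cos_sq θ]

lemma inner_unitPerp_self (θ : ℝ) : (inner ℝ (unitPerp θ) (unitPerp θ) : ℝ) = 1 := by
  rw [plane_inner, unitPerp_zero, unitPerp_one]; linarith [Real.sin_sq_add_cos_sq θ]

lemma inner_unitVec_unitPerp (θ : ℝ) : (inner ℝ (unitVec θ) (unitPerp θ) : ℝ) = 0 := by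
  rw [plane_inner, unitVec_zero, unitVec_one, unitPerp_zero, unitPerp_one]; ring

lemma inner_unitPerp_unitVec (θ : ℝ) : (inner ℝ (unitPerp θ) (unitVec θ) : ℝ) = 0 := by
  rw [real_inner_comm, inner_unitVec_unitPerp]

lemma norm_unitVec (θ : ℝ) : ‖unitVec θ‖ = 1 := by
  have := inner_unitVec_self θ
  rw [real_inner_self_eq_norm_sq] at this
  exact (pow_eq_one_iff_of_nonneg (norm_nonneg _) two_ne_zero).1 this

lemma hasDerivAt_unitVec {θ : ℝ → ℝ} {θ' t : ℝ} (h : HasDerivAt θ θ' t) :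
    HasDerivAt (fun t => unitVec (θ t)) (θ' • unitPerp (θ t)) t := by
  have := ((h.cos).smul_const (EuclideanSpace.single (0 : Fin 2) (1 : ℝ))).add
    ((h.sin).smul_const (EuclideanSpace.single (1 : Fin 2) (1 : ℝ)))
  convert! this using 1
  simp only [unitPerp]; module

lemma hasDerivAt_unitPerp {θ : ℝ → ℝ} {θ' t : ℝ} (h : HasDerivAt θ θ' t) :
    HasDerivAt (fun t => unitPerp (θ t)) (-θ' • unitVec (θ t)) t := by
  have := ((h.sin.neg).smul_const (EuclideanSpace.single (0 : Fin 2) (1 : ℝ))).add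
    ((h.cos).smul_const (EuclideanSpace.single (1 : Fin 2) (1 : ℝ)))
  convert! this using 1
  simp only [unitVec]; module

/-- The point with polar coordinates `(ρ, θ)`. -/
def polarPoint (ρ θ : ℝ) : Plane := ρ • unitVec θ

/-- The velocity at the point with polar coordinates `(ρ, θ)` with `ρ ρ' = c` and angular
momentum `ρ² θ' = ℓ`. -/
def polarVelocity (ℓ ρ θ c : ℝ) : Plane := (c / ρ) • unitVec θ + (ℓ / ρ) • unitPerp θ

lemma norm_polarPoint {ρ : ℝ} (hρ : 0 ≤ ρ) (θ : ℝ) : ‖polarPoint ρ θ‖ = ρ := by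
  simp [polarPoint, norm_smul, norm_unitVec, abs_of_nonneg hρ]

lemma inner_polarPoint_polarVelocity {ρ : ℝ} (hρ : 0 < ρ) (ℓ θ c : ℝ) :
    (inner ℝ (polarPoint ρ θ) (polarVelocity ℓ ρ θ c) : ℝ) = c := by
  simp only [polarPoint, polarVelocity, inner_add_right, real_inner_smul_left,
    real_inner_smul_right, inner_unitVec_self, inner_unitVec_unitPerp]
  field_simp; ring

lemma inner_polarVelocity_self {ρ : ℝ} (hρ : 0 < ρ) (ℓ θ c : ℝ) :
    (inner ℝ (polarVelocity ℓ ρ θ c) (polarVelocity ℓ ρ θ c) : ℝ) = (c ^ 2 + ℓ ^ 2) / ρ ^ 2 := by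
  simp only [polarVelocity, inner_add_right, inner_add_left, real_inner_smul_left,
    real_inner_smul_right, inner_unitVec_self, inner_unitVec_unitPerp, inner_unitPerp_self,
    inner_unitPerp_unitVec]
  field_simp; ring

lemma radialMetric_polarVelocity {β : ℝ → ℝ} {hβ : ContDiff ℝ ∞ β}
    {hpos : ∀ s, 0 ≤ s → 0 < 1 + s * β s} {ρ : ℝ} (hρ : 0 < ρ) (ℓ θ c : ℝ) :
    (radialMetric β hβ hpos).inner (polarPoint ρ θ) (polarVelocity ℓ ρ θ c)
      (polarVelocity ℓ ρ θ c) = (c ^ 2 * (1 + ρ ^ 2 * β (ρ ^ 2)) + ℓ ^ 2) / ρ ^ 2 := by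
  rw [radialMetric_inner, inner_polarPoint_polarVelocity hρ, inner_polarVelocity_self hρ,
    norm_polarPoint hρ.le]
  field_simp; ring

/-- The variable c = ρρ' is the inner product ⟨x, u⟩ that enters the metric. The hypothesis `heq` is
the time derivative of the energy relation `hen` divided by 2c. It is assumed separately because c
vanishes at turning points, and identically on circular orbits. -/
theorem isMotion_polar {β : ℝ → ℝ} {hβ : ContDiff ℝ ∞ β}
    {hpos : ∀ s, 0 ≤ s → 0 < 1 + s * β s} {k ℓ : ℝ} {I : Set ℝ} {ρ θ c C : ℝ → ℝ}
    (hρ : ∀ t ∈ I, 0 < ρ t) (hρ' : ∀ t ∈ I, HasDerivAt ρ (c t / ρ t) t)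
    (hθ : ∀ t ∈ I, HasDerivAt θ (ℓ / ρ t ^ 2) t) (hc : ∀ t ∈ I, HasDerivAt c (C t) t)
    (hen : ∀ t ∈ I, c t ^ 2 * (1 + ρ t ^ 2 * β (ρ t ^ 2)) + ℓ ^ 2 = 2 * ρ t - k * ρ t ^ 2)
    (heq : ∀ t ∈ I, (β (ρ t ^ 2) + ρ t ^ 2 * deriv β (ρ t ^ 2)) * c t ^ 2
      + (1 + ρ t ^ 2 * β (ρ t ^ 2)) * C t = 1 / ρ t - k) :
    IsMotion (lagrangian (radialMetric β hβ hpos) keplerPotential)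
      (fun t => polarPoint (ρ t) (θ t)) (fun t => polarVelocity ℓ (ρ t) (θ t) (c t)) I := by
  intro t ht
  have hr := hρ t ht
  have hne : polarPoint (ρ t) (θ t) ≠ 0 := by
    rw [← norm_ne_zero_iff, norm_polarPoint hr.le]; exact hr.ne'
  have he := hasDerivAt_unitVec (hθ t ht)
  have he' := hasDerivAt_unitPerp (hθ t ht)
  have hγ : HasDerivAt (fun t => polarPoint (ρ t) (θ t))
      (polarVelocity ℓ (ρ t) (θ t) (c t)) t := by
    have := (hρ' t ht).smul he
    convert! this using 1
    simp only [polarVelocity, smul_smul]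
    rw [add_comm]; congr 2; field_simp
  refine ⟨hne, hγ, fun w => ?_⟩
  simp only [fderiv_velocity_lagrangian]
  rw [fderiv_position_lagrangian hne]
  set B := β (ρ t ^ 2) with hB
  set B' := deriv β (ρ t ^ 2) with hB'
  -- The acceleration is central: constancy of ℓ kills its angular component (`key2`), and the
  -- radial one comes from `hen` and `heq` (`key`).
  have hv : HasDerivAt (fun t => polarVelocity ℓ (ρ t) (θ t) (c t))
      (-(B' * c t ^ 2 + B * C t + 1 / ρ t ^ 3) • polarPoint (ρ t) (θ t)) t := by
    have h1 := (((hc t ht).div (hρ' t ht) hr.ne').smul he).add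
      ((((hρ' t ht).inv hr.ne').const_mul ℓ).smul he')
    convert! h1 using 1
    have key : (C t * ρ t - c t * (c t / ρ t)) / ρ t ^ 2 - ℓ / ρ t * (ℓ / ρ t ^ 2) =
        -(B' * c t ^ 2 + B * C t + 1 / ρ t ^ 3) * ρ t := by
      have h2 := hen t ht
      have h3 := heq t ht
      rw [← hB] at h2 h3
      rw [← hB'] at h3
      field_simp at h3 ⊢
      have h4 : ℓ ^ 2 = 2 * ρ t - k * ρ t ^ 2 - c t ^ 2 * (1 + ρ t ^ 2 * B) := by linarith
      rw [h4]
      linear_combination h3 * ρ t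
    have key2 : c t / ρ t * (ℓ / ρ t ^ 2) + ℓ * (-(c t / ρ t) / ρ t ^ 2) = 0 := by
      field_simp; ring
    simp only [polarPoint, smul_smul, ← key, Pi.inv_apply, Pi.div_apply, ← div_eq_mul_inv]
    have key3 := congrArg (fun z : ℝ => z • unitPerp (θ t)) key2
    simp only [add_smul, zero_smul] at key3
    rw [sub_smul]
    linear_combination (norm := module) -key3
  have hN : HasDerivAt (fun t => β (‖polarPoint (ρ t) (θ t)‖ ^ 2)) (B' * (2 * c t)) t := by
    have hb : HasDerivAt β (deriv β (‖polarPoint (ρ t) (θ t)‖ ^ 2))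
        (‖polarPoint (ρ t) (θ t)‖ ^ 2) :=
      (hβ.differentiable (by simp)).differentiableAt.hasDerivAt
    have := hb.comp t hγ.norm_sq
    convert! this using 1
    rw [inner_polarPoint_polarVelocity hr, norm_polarPoint hr.le]
  have hw : HasDerivAt (fun _ : ℝ => w) 0 t := hasDerivAt_const _ _
  have hci := hγ.inner ℝ hv
  have h := (hv.inner ℝ hw).add (hN.mul (hci.mul (hγ.inner ℝ hw)))
  convert! h using 1
  simp only [Pi.mul_apply, inner_zero_right, inner_polarPoint_polarVelocity hr, norm_polarPoint hr.le,
    real_inner_smul_left, real_inner_smul_right, zero_add, real_inner_self_eq_norm_sq]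
  rw [← real_inner_self_eq_norm_sq (polarVelocity ℓ (ρ t) (θ t) (c t)),
    inner_polarVelocity_self hr, ← hB, ← hB']
  have hC : -(B' * c t ^ 2 + B * C t + 1 / ρ t ^ 3) * ρ t ^ 2 + (c t ^ 2 + ℓ ^ 2) / ρ t ^ 2
      = C t := by
    have h2 := hen t ht
    have h3 := heq t ht
    rw [← hB] at h2 h3
    rw [← hB'] at h3
    have h4 : ℓ ^ 2 = 2 * ρ t - k * ρ t ^ 2 - c t ^ 2 * (1 + ρ t ^ 2 * B) := by linarith
    rw [h4]
    field_simp at h3 ⊢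
    linear_combination -ρ t * h3
  rw [hC]
  ring

lemma exists_polar_angle (a b : ℝ) :
    ∃ φ : ℝ, √(a ^ 2 + b ^ 2) * Real.cos φ = a ∧ √(a ^ 2 + b ^ 2) * Real.sin φ = b := by
  have hn : ‖(⟨a, b⟩ : ℂ)‖ = √(a ^ 2 + b ^ 2) := by
    rw [Complex.norm_eq_sqrt_sq_add_sq]
  exact ⟨Complex.arg ⟨a, b⟩, by rw [← hn, Complex.norm_mul_cos_arg],
    by rw [← hn, Complex.norm_mul_sin_arg]⟩

lemma eq_polar (q u : Plane) (hq : q ≠ 0) :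
    ∃ θ ℓ : ℝ, q = polarPoint ‖q‖ θ ∧ u = polarVelocity ℓ ‖q‖ θ (inner ℝ q u) := by
  have hn : 0 < ‖q‖ := norm_pos_iff.2 hq
  obtain ⟨θ, hc, hs⟩ := exists_polar_angle (q 0) (q 1)
  rw [← plane_norm_sq, Real.sqrt_sq hn.le] at hc hs
  refine ⟨θ, q 0 * u 1 - q 1 * u 0, plane_ext ?_ ?_, plane_ext ?_ ?_⟩
  · simp [polarPoint, unitVec_zero, hc]
  · simp [polarPoint, unitVec_one, hs]
  · simp only [polarVelocity, PiLp.add_apply, PiLp.smul_apply, unitVec_zero, unitPerp_zero,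
      smul_eq_mul, plane_inner]
    rw [← hc, ← hs]; field_simp
    linear_combination (-u 0) * (Real.sin_sq_add_cos_sq θ)
  · simp only [polarVelocity, PiLp.add_apply, PiLp.smul_apply, unitVec_one, unitPerp_one,
      smul_eq_mul, plane_inner]
    rw [← hc, ← hs]; field_simp
    linear_combination (-u 1) * (Real.sin_sq_add_cos_sq θ)

/-! ### Integrals over the eccentric anomaly and inversion of the time integral -/

lemma integral_odd_comp_cos {g : ℝ → ℝ} (hg : Continuous g) (hodd : ∀ y, g (-y) = -g y) (r : ℝ) :
    ∫ φ in (0 : ℝ)..(2 * Real.pi), g (r * Real.cos φ) = 0 := by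
  have hc : Continuous fun φ => g (r * Real.cos φ) := by fun_prop
  have h1 : ∫ φ in (0 : ℝ)..Real.pi, g (r * Real.cos (φ + Real.pi)) =
      ∫ φ in Real.pi..(2 * Real.pi), g (r * Real.cos φ) := by
    rw [intervalIntegral.integral_comp_add_right (fun φ => g (r * Real.cos φ))]
    congr 1 <;> ring
  rw [← intervalIntegral.integral_add_adjacent_intervals (hc.intervalIntegrable 0 Real.pi)
    (hc.intervalIntegrable _ _), ← h1]
  simp [Real.cos_add_pi, hodd]

lemma one_sub_mul_cos_pos {r : ℝ} (h0 : 0 ≤ r) (h1 : r < 1) (φ : ℝ) : 0 < 1 - r * Real.cos φ := by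
  nlinarith [Real.cos_le_one φ, Real.neg_one_le_cos φ]

/-- The mean value of `1 / (1 - r cos φ)`, from the primitive given by the true anomaly. -/
lemma integral_inv_one_sub_mul_cos {r : ℝ} (h0 : 0 ≤ r) (h1 : r < 1) :
    ∫ φ in (0 : ℝ)..(2 * Real.pi), (1 - r * Real.cos φ)⁻¹ = 2 * Real.pi / √(1 - r ^ 2) := by
  set d := √(1 - r ^ 2) with hd
  have hd2 : d ^ 2 = 1 - r ^ 2 := Real.sq_sqrt (by nlinarith)
  have hdpos : 0 < d := Real.sqrt_pos.2 (by nlinarith)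
  -- The true anomaly is written as φ plus a periodic correction. The denominator stays positive, so
  -- this primitive is smooth on the whole line, whereas the formula with tan(φ/2) jumps at odd
  -- multiples of π.
  have hder : ∀ φ : ℝ, HasDerivAt (fun φ => (φ + 2 * Real.arctan
      (r * Real.sin φ / (1 + d - r * Real.cos φ))) / d) (1 - r * Real.cos φ)⁻¹ φ := by
    intro φ
    have hp := one_sub_mul_cos_pos h0 h1 φ
    have hp' : 0 < 1 + d - r * Real.cos φ := by linarith
    have hq := ((Real.hasDerivAt_sin φ).const_mul r).div
      (((Real.hasDerivAt_cos φ).const_mul r).const_sub (1 + d)) hp'.ne'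
    have h := ((hasDerivAt_id φ).add ((hq.arctan).const_mul 2)).div_const d
    convert! h using 1
    have hsc := Real.sin_sq_add_cos_sq φ
    simp only [Pi.div_apply]
    set c := Real.cos φ
    set s := Real.sin φ
    have hs : s ^ 2 = 1 - c ^ 2 := by linarith
    have hsum : (1 + d - r * c) ^ 2 + (r * s) ^ 2 = 2 * (1 + d) * (1 - r * c) := by
      rw [mul_pow, hs]; linear_combination hd2
    have hden : 1 + (r * s / (1 + d - r * c)) ^ 2 =
        2 * (1 + d) * (1 - r * c) / (1 + d - r * c) ^ 2 := by
      rw [← hsum]; field_simp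
    have hnum : (r * c * (1 + d - r * c) - r * s * -(r * -s)) =
        r * c * (1 + d) - r ^ 2 := by linear_combination (-r ^ 2) * hs
    rw [hnum, hden]
    have h1d : 0 < 1 + d := by linarith
    field_simp
    linear_combination hd2
  have hcont : Continuous fun φ : ℝ => (1 - r * Real.cos φ)⁻¹ :=
    (by fun_prop : Continuous fun φ : ℝ => 1 - r * Real.cos φ).inv₀
      fun φ => (one_sub_mul_cos_pos h0 h1 φ).ne'
  rw [intervalIntegral.integral_eq_sub_of_hasDerivAt (fun φ _ => hder φ)
    (hcont.intervalIntegrable _ _)]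
  simp

/-- Inversion of `τ = ∫ w` for a periodic density `w ≥ 0` that vanishes on no interval. -/
lemma exists_inverse_integral {w : ℝ → ℝ} {P : ℝ} (hP : 0 < P) (hw : Continuous w)
    (hper : Function.Periodic w P) (hnn : ∀ x, 0 ≤ w x)
    (hpos : ∀ a b, a < b → ∃ c ∈ Set.Icc a b, 0 < w c) (φ₀ : ℝ) :
    ∃ ψ : ℝ → ℝ, StrictMono ψ ∧ Continuous ψ ∧ (∀ φ, ψ (∫ x in φ₀..φ, w x) = φ) ∧
      (∀ t, ∫ x in φ₀..ψ t, w x = t) ∧ 0 < (∫ x in (0 : ℝ)..P, w x) ∧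
      (∀ t, ψ (t + ∫ x in (0 : ℝ)..P, w x) = ψ t + P) ∧
      ∀ t, w (ψ t) ≠ 0 → HasDerivAt ψ (w (ψ t))⁻¹ t := by
  set τ : ℝ → ℝ := fun φ => ∫ x in φ₀..φ, w x with hτ
  have hi : ∀ a b, IntervalIntegrable w MeasureTheory.volume a b := fun a b =>
    hw.intervalIntegrable a b
  have hder : ∀ φ, HasDerivAt τ (w φ) φ := fun φ =>
    intervalIntegral.integral_hasDerivAt_right (hi _ _)
      hw.aestronglyMeasurable.stronglyMeasurableAtFilter hw.continuousAt
  have hmono : StrictMono τ := by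
    intro a b hab
    have h1 : 0 < ∫ x in a..b, w x :=
      intervalIntegral.integral_pos hab hw.continuousOn (fun x _ => hnn x) (hpos a b hab)
    have h2 := intervalIntegral.integral_add_adjacent_intervals (hi φ₀ a) (hi a b)
    simp only [hτ]; linarith
  have hT : 0 < ∫ x in (0 : ℝ)..P, w x :=
    intervalIntegral.integral_pos hP hw.continuousOn (fun x _ => hnn x) (hpos _ _ hP)
  have hτ0 : τ = fun φ => (∫ x in (0 : ℝ)..φ, w x) - ∫ x in (0 : ℝ)..φ₀, w x := by
    funext φ
    have h2 := intervalIntegral.integral_add_adjacent_intervals (hi 0 φ₀) (hi φ₀ φ)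
    simp only [hτ]; linarith
  have hcont : Continuous τ := continuous_iff_continuousAt.2 fun φ => (hder φ).continuousAt
  have hsurj : Function.Surjective τ := by
    refine hcont.surjective ?_ ?_
    · rw [hτ0]
      exact Filter.tendsto_atTop_add_const_right _ _
        (hper.tendsto_atTop_intervalIntegral_of_pos hT hP)
    · rw [hτ0]
      exact Filter.tendsto_atBot_add_const_right _ _
        (hper.tendsto_atBot_intervalIntegral_of_pos hT hP)
  set o := hmono.orderIsoOfSurjective τ hsurj with ho
  have ho' : ∀ φ, o φ = τ φ := fun φ => rfl
  have hl : ∀ φ, o.symm (τ φ) = φ := fun φ => by rw [← ho', o.symm_apply_apply]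
  have hr : ∀ t, τ (o.symm t) = t := fun t => by rw [← ho', o.apply_symm_apply]
  refine ⟨o.symm, o.symm.strictMono, o.symm.continuous, hl, hr, hT, ?_, ?_⟩
  · intro t
    have h : τ (o.symm t + P) = t + ∫ x in (0 : ℝ)..P, w x := by
      have h2 := intervalIntegral.integral_add_adjacent_intervals (hi φ₀ (o.symm t))
        (hi (o.symm t) (o.symm t + P))
      have h3 := hper.intervalIntegral_add_eq (o.symm t) 0
      have h4 := hr t
      simp only [hτ, zero_add] at h2 h3 h4 ⊢
      linarith
    rw [← h, hl]
  · intro t ht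
    exact HasDerivAt.of_local_left_inverse o.symm.continuous.continuousAt (hder _) ht
      (Filter.Eventually.of_forall hr)

/-! ### Orbits parametrized by the eccentric anomaly -/

/-- The radius `(1 - r cos φ) / k` at the eccentric anomaly `φ`. -/
def orbitRadius (k r φ : ℝ) : ℝ := (1 - r * Real.cos φ) / k

lemma orbitRadius_nonneg {k r : ℝ} (hk : 0 < k) (h0 : 0 ≤ r) (h1 : r ≤ 1) (φ : ℝ) :
    0 ≤ orbitRadius k r φ := by
  refine div_nonneg ?_ hk.le
  nlinarith [Real.cos_le_one φ, Real.neg_one_le_cos φ]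

lemma orbitRadius_pos {k r : ℝ} (hk : 0 < k) (h0 : 0 ≤ r) (h1 : r < 1) (φ : ℝ) :
    0 < orbitRadius k r φ := div_pos (one_sub_mul_cos_pos h0 h1 φ) hk

lemma continuous_orbitRadius (k r : ℝ) : Continuous (orbitRadius k r) := by
  unfold orbitRadius; fun_prop

lemma orbitRadius_add_two_pi (k r φ : ℝ) :
    orbitRadius k r (φ + 2 * Real.pi) = orbitRadius k r φ := by simp [orbitRadius]

section
variable {β : ℝ → ℝ} {hβ : ContDiff ℝ ∞ β} {hpos : ∀ s, 0 ≤ s → 0 < 1 + s * β s} {A : ℝ → ℝ}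

lemma mul_deriv_of_sq_eq (hβ : ContDiff ℝ ∞ β) (hA : Differentiable ℝ A)
    (hAβ : ∀ ρ, 0 < ρ → 1 + ρ ^ 2 * β (ρ ^ 2) = A ρ ^ 2) {ρ : ℝ} (hρ : 0 < ρ) :
    A ρ * deriv A ρ = ρ * (β (ρ ^ 2) + ρ ^ 2 * deriv β (ρ ^ 2)) := by
  have h1 : HasDerivAt (fun x => A x ^ 2) _ ρ := (hA ρ).hasDerivAt.pow 2
  have hb : HasDerivAt β (deriv β (ρ ^ 2)) (ρ ^ 2) :=
    (hβ.differentiable (by simp)).differentiableAt.hasDerivAt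
  have hsq : HasDerivAt (fun x : ℝ => x ^ 2) _ ρ := hasDerivAt_pow 2 ρ
  have h2 : HasDerivAt (fun x : ℝ => 1 + x ^ 2 * β (x ^ 2)) _ ρ :=
    (hsq.mul (HasDerivAt.comp (h := fun x : ℝ => x ^ 2) ρ hb hsq)).const_add 1
  have h3 : HasDerivAt (fun x : ℝ => 1 + x ^ 2 * β (x ^ 2)) _ ρ :=
    h1.congr_of_eventuallyEq (by
      filter_upwards [lt_mem_nhds hρ] with x hx using hAβ x hx)
  have h4 := h2.unique h3
  simp at h4
  linear_combination -(1 / 2 : ℝ) * h4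

/-- The product `ρ ρ'` along an orbit, at the eccentric anomaly `φ`. -/
def orbitMomentum (A : ℝ → ℝ) (k r φ : ℝ) : ℝ :=
  r * Real.sin φ / (√k * A (orbitRadius k r φ))

/-- Conservation of energy along an orbit. -/
lemma orbit_energy (hApos : ∀ ρ, 0 ≤ ρ → 0 < A ρ)
    (hAβ : ∀ ρ, 0 < ρ → 1 + ρ ^ 2 * β (ρ ^ 2) = A ρ ^ 2) {k r ℓ φ : ℝ} (hk : 0 < k)
    (hℓ : k * ℓ ^ 2 = 1 - r ^ 2) (hρ : 0 < orbitRadius k r φ) :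
    orbitMomentum A k r φ ^ 2 * (1 + orbitRadius k r φ ^ 2 * β (orbitRadius k r φ ^ 2)) + ℓ ^ 2 =
      2 * orbitRadius k r φ - k * orbitRadius k r φ ^ 2 := by
  rw [hAβ _ hρ]
  have hA' := hApos _ hρ.le
  have hk' : √k ^ 2 = k := Real.sq_sqrt hk.le
  have hkpos : 0 < √k := Real.sqrt_pos.2 hk
  have h1 : orbitMomentum A k r φ ^ 2 * A (orbitRadius k r φ) ^ 2 = r ^ 2 * Real.sin φ ^ 2 / k := by
    unfold orbitMomentum
    rw [div_pow, mul_pow, mul_pow, hk']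
    field_simp
  rw [h1]
  unfold orbitRadius
  field_simp
  have := Real.sin_sq_add_cos_sq φ
  linear_combination hℓ + r ^ 2 * this

/-- The prescribed speed of ψ turns ρρ' into `orbitMomentum`, the value dictated by conservation of
energy. The radial equation then follows by differentiating `orbitMomentum`. -/
lemma isMotion_orbit (hA : Differentiable ℝ A) (hApos : ∀ ρ, 0 ≤ ρ → 0 < A ρ)
    (hAβ : ∀ ρ, 0 < ρ → 1 + ρ ^ 2 * β (ρ ^ 2) = A ρ ^ 2) {k r ℓ : ℝ} (hk : 0 < k)
    (hℓ : k * ℓ ^ 2 = 1 - r ^ 2) {I : Set ℝ} {ψ θ : ℝ → ℝ}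
    (hρ : ∀ t ∈ I, 0 < orbitRadius k r (ψ t))
    (hψ : ∀ t ∈ I, HasDerivAt ψ
      (A (orbitRadius k r (ψ t)) * orbitRadius k r (ψ t) / √k)⁻¹ t)
    (hθ : ∀ t ∈ I, HasDerivAt θ (ℓ / orbitRadius k r (ψ t) ^ 2) t) :
    IsMotion (lagrangian (radialMetric β hβ hpos) keplerPotential)
      (fun t => polarPoint (orbitRadius k r (ψ t)) (θ t))
      (fun t => polarVelocity ℓ (orbitRadius k r (ψ t)) (θ t) (orbitMomentum A k r (ψ t))) I := by
  have hk' : √k ^ 2 = k := Real.sq_sqrt hk.le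
  have hkpos : 0 < √k := Real.sqrt_pos.2 hk
  have hρ' : ∀ t ∈ I, HasDerivAt (fun t => orbitRadius k r (ψ t))
      (orbitMomentum A k r (ψ t) / orbitRadius k r (ψ t)) t := by
    intro t ht
    have h := (((hψ t ht).cos.const_mul r).const_sub 1).div_const k
    convert! h using 1
    have := hApos _ (hρ t ht).le
    have h2 := hρ t ht
    unfold orbitMomentum
    field_simp
    rw [hk']
  refine isMotion_polar (k := k) (C := fun t => r * Real.cos (ψ t) / (A (orbitRadius k r (ψ t)) ^ 2
      * orbitRadius k r (ψ t)) - r * Real.sin (ψ t) * (deriv A (orbitRadius k r (ψ t)) *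
      (orbitMomentum A k r (ψ t) / orbitRadius k r (ψ t))) / (√k * A (orbitRadius k r (ψ t)) ^ 2))
    hρ hρ' hθ ?_ (fun t ht => orbit_energy hApos hAβ hk hℓ (hρ t ht)) ?_
  · intro t ht
    have hAr := hApos _ (hρ t ht).le
    have hr := hρ t ht
    have hAc : HasDerivAt (fun t => A (orbitRadius k r (ψ t))) _ t :=
      (hA _).hasDerivAt.comp t (hρ' t ht)
    have h := ((hψ t ht).sin.const_mul r).div (hAc.const_mul √k) (by positivity)
    convert! h using 1
    field_simp
  · intro t ht
    have hAr := hApos _ (hρ t ht).le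
    have hr := hρ t ht
    have hd := mul_deriv_of_sq_eq hβ hA hAβ hr
    have hy : r * Real.cos (ψ t) = 1 - k * orbitRadius k r (ψ t) := by
      unfold orbitRadius; field_simp; ring
    have hm : r * Real.sin (ψ t) =
        orbitMomentum A k r (ψ t) * (√k * A (orbitRadius k r (ψ t))) := by
      unfold orbitMomentum; field_simp
    rw [hAβ _ hr, hm, hy]
    have hd' : β (orbitRadius k r (ψ t) ^ 2) + orbitRadius k r (ψ t) ^ 2 *
        deriv β (orbitRadius k r (ψ t) ^ 2) = A (orbitRadius k r (ψ t)) *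
        deriv A (orbitRadius k r (ψ t)) / orbitRadius k r (ψ t) := by
      rw [hd]; field_simp
    rw [hd']
    field_simp
    ring

end

section
variable {β : ℝ → ℝ} {hβ : ContDiff ℝ ∞ β} {hpos : ∀ s, 0 ≤ s → 0 < 1 + s * β s} {A : ℝ → ℝ}

lemma exists_cos_ne_one {a b : ℝ} (hab : a < b) : ∃ c ∈ Set.Icc a b, Real.cos c < 1 := by
  by_cases ha : Real.cos a = 1
  · have hpi := Real.pi_pos
    have hs : Real.sin a = 0 := by
      have := Real.sin_sq_add_cos_sq a
      rw [ha] at this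
      exact pow_eq_zero_iff two_ne_zero |>.1 (by linarith)
    set x := min (b - a) Real.pi with hx
    have hx0 : 0 < x := lt_min (by linarith) hpi
    refine ⟨a + x, ⟨by linarith, by linarith [min_le_left (b - a) Real.pi]⟩, ?_⟩
    rw [Real.cos_add, ha, hs, one_mul, zero_mul, sub_zero, ← Real.cos_zero]
    exact Real.cos_lt_cos_of_nonneg_of_le_pi le_rfl (min_le_right _ _) hx0
  · exact ⟨a, ⟨le_rfl, hab.le⟩, lt_of_le_of_ne (Real.cos_le_one a) ha⟩

/-- The time density `dt / dφ` with respect to the eccentric anomaly. -/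
def timeDensity (A : ℝ → ℝ) (k r φ : ℝ) : ℝ :=
  A (orbitRadius k r φ) * orbitRadius k r φ / √k

/-- The case r = 1 of radial orbits is included. The density then vanishes at the collisions, the
multiples of 2π, where ψ is still continuous; its derivative is claimed only where the radius is
positive. -/
lemma exists_eccentric_anomaly (hA : Differentiable ℝ A) (hApos : ∀ ρ, 0 ≤ ρ → 0 < A ρ)
    {k r : ℝ} (hk : 0 < k) (h0 : 0 ≤ r) (h1 : r ≤ 1) (φ₀ : ℝ) :
    ∃ ψ : ℝ → ℝ, StrictMono ψ ∧ Continuous ψ ∧ (∀ φ, ψ (∫ x in φ₀..φ, timeDensity A k r x) = φ) ∧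
      (∀ t, ∫ x in φ₀..ψ t, timeDensity A k r x = t) ∧
      0 < (∫ x in (0 : ℝ)..(2 * Real.pi), timeDensity A k r x) ∧
      (∀ t, ψ (t + ∫ x in (0 : ℝ)..(2 * Real.pi), timeDensity A k r x) = ψ t + 2 * Real.pi) ∧
      ∀ t, 0 < orbitRadius k r (ψ t) → HasDerivAt ψ (timeDensity A k r (ψ t))⁻¹ t := by
  have hkpos : 0 < √k := Real.sqrt_pos.2 hk
  have hposw : ∀ φ, 0 < orbitRadius k r φ → 0 < timeDensity A k r φ := fun φ hφ =>
    div_pos (mul_pos (hApos _ hφ.le) hφ) hkpos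
  have hcont : Continuous (timeDensity A k r) := by
    have := continuous_orbitRadius k r
    exact ((hA.continuous.comp this).mul this).div_const _
  obtain ⟨ψ, m, c, e1, e2, e3, e4, e5⟩ := exists_inverse_integral (w := timeDensity A k r)
    Real.two_pi_pos hcont
    (fun φ => by simp only [timeDensity, orbitRadius_add_two_pi])
    (fun φ => div_nonneg (mul_nonneg (hApos _ (orbitRadius_nonneg hk h0 h1 φ)).le
      (orbitRadius_nonneg hk h0 h1 φ)) hkpos.le)
    (fun a b hab => by
      obtain ⟨c, hc, hc1⟩ := exists_cos_ne_one hab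
      refine ⟨c, hc, hposw c (div_pos ?_ hk)⟩
      nlinarith [Real.neg_one_le_cos c]) φ₀
  exact ⟨ψ, m, c, e1, e2, e3, e4, fun t ht => e5 t (hposw _ ht).ne'⟩

/-- Radial orbits run into the origin. -/
lemma isCollisionState_radial (hA : Differentiable ℝ A) (hApos : ∀ ρ, 0 ≤ ρ → 0 < A ρ)
    (hAβ : ∀ ρ, 0 < ρ → 1 + ρ ^ 2 * β (ρ ^ 2) = A ρ ^ 2) {k : ℝ} (hk : 0 < k) {φ₀ : ℝ}
    (hφ₀ : 0 < orbitRadius k 1 φ₀) (θ : ℝ) :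
    IsCollisionState (lagrangian (radialMetric β hβ hpos) keplerPotential)
      (polarPoint (orbitRadius k 1 φ₀) θ)
      (polarVelocity 0 (orbitRadius k 1 φ₀) θ (orbitMomentum A k 1 φ₀)) := by
  obtain ⟨ψ, hm, hc, e1, e2, -, -, e5⟩ := exists_eccentric_anomaly hA hApos hk zero_le_one le_rfl φ₀
  have hψ0 : ψ 0 = φ₀ := by simpa using e1 φ₀
  have hP := Real.two_pi_pos
  -- The arc between two consecutive collisions that contains φ₀; the inequalities are strict
  -- because the initial radius is positive.
  obtain ⟨n, hn1, hn2⟩ : ∃ n : ℤ, n * (2 * Real.pi) < φ₀ ∧ φ₀ < (n + 1) * (2 * Real.pi) := by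
    refine ⟨⌊φ₀ / (2 * Real.pi)⌋, lt_of_le_of_ne ?_ ?_, ?_⟩
    · exact (le_div_iff₀ hP).1 (Int.floor_le _)
    · intro h
      rw [← h, orbitRadius, Real.cos_int_mul_two_pi] at hφ₀
      simp at hφ₀
    · exact (div_lt_iff₀ hP).1 (Int.lt_floor_add_one _)
  have hmem : ∀ φ, n * (2 * Real.pi) < φ → φ < (n + 1) * (2 * Real.pi) →
      0 < orbitRadius k 1 φ := by
    intro φ h1 h2
    refine div_pos ?_ hk
    rw [one_mul, sub_pos]
    refine lt_of_le_of_ne (Real.cos_le_one _) fun h => ?_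
    obtain ⟨m, hm⟩ := (Real.cos_eq_one_iff φ).1 h
    rw [← hm] at h1 h2
    have h1' := lt_of_mul_lt_mul_right h1 hP.le
    have h2' := lt_of_mul_lt_mul_right h2 hP.le
    norm_cast at h1' h2'
    omega
  set a := ∫ x in φ₀..(n * (2 * Real.pi)), timeDensity A k 1 x with ha
  set b := ∫ x in φ₀..((n + 1) * (2 * Real.pi)), timeDensity A k 1 x with hb
  have hψa : ψ a = n * (2 * Real.pi) := e1 _
  have hψb : ψ b = (n + 1) * (2 * Real.pi) := e1 _
  have hI : ∀ t ∈ Set.Ioo a b, 0 < orbitRadius k 1 (ψ t) := fun t ht =>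
    hmem _ (hψa ▸ hm ht.1) (hψb ▸ hm ht.2)
  refine ⟨fun t => polarPoint (orbitRadius k 1 (ψ t)) θ, fun t => polarVelocity 0
    (orbitRadius k 1 (ψ t)) θ (orbitMomentum A k 1 (ψ t)), a, b, ?_, ?_, ?_, ?_, ?_, Or.inr ?_⟩
  · rw [← hm.lt_iff_lt, hψa, hψ0]; exact hn1
  · rw [← hm.lt_iff_lt, hψb, hψ0]; exact hn2
  · refine isMotion_orbit (θ := fun _ => θ) hA hApos hAβ hk (by simp) hI
      (fun t ht => e5 t (hI t ht)) (fun t _ => ?_)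
    simpa using hasDerivAt_const t θ
  · simp only [hψ0]
  · simp only [hψ0]
  · have hcont : Continuous fun t => polarPoint (orbitRadius k 1 (ψ t)) θ :=
      ((continuous_orbitRadius k 1).comp hc).smul continuous_const
    have h0 : polarPoint (orbitRadius k 1 (ψ b)) θ = 0 := by
      have h : orbitRadius k 1 ((n + 1) * (2 * Real.pi)) = 0 := by
        have := Real.cos_int_mul_two_pi (n + 1)
        push_cast at this
        simp [orbitRadius, this]
      rw [hψb, h, polarPoint, zero_smul]
    rw [← h0]
    exact (hcont.tendsto b).mono_left nhdsWithin_le_nhds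

/-! ### Closing of the orbits and the Zoll criterion -/

/-- Dividing A = 1 + (1 - y) f(y) by ρ√k gives √k (1/(1 - y) + f(y)). The first term is the Kepler
integral and the second is odd in y = r cos φ. -/
lemma orbit_angle_period {k : ℝ} (hk : 0 < k) {f : ℝ → ℝ} (hf : Continuous f)
    (hodd : ∀ y, f (-y) = -f y)
    (hAf : ∀ y ∈ Set.Icc (-1 : ℝ) 1, A ((1 - y) / k) = 1 + (1 - y) * f y)
    {r ℓ : ℝ} (h0 : 0 ≤ r) (h1 : r < 1) (hℓ : k * ℓ ^ 2 = 1 - r ^ 2) :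
    ∫ φ in (0 : ℝ)..(2 * Real.pi), A (orbitRadius k r φ) / (orbitRadius k r φ * √k) =
      2 * Real.pi / |ℓ| := by
  have hk' : √k ^ 2 = k := Real.sq_sqrt hk.le
  have hkpos : 0 < √k := Real.sqrt_pos.2 hk
  have hd : √(1 - r ^ 2) = √k * |ℓ| := by
    rw [← hℓ, Real.sqrt_mul hk.le, Real.sqrt_sq_eq_abs]
  have hmem : ∀ φ, r * Real.cos φ ∈ Set.Icc (-1 : ℝ) 1 := fun φ =>
    ⟨by nlinarith [Real.neg_one_le_cos φ], by nlinarith [Real.cos_le_one φ]⟩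
  have heq : ∀ φ, A (orbitRadius k r φ) / (orbitRadius k r φ * √k) =
      √k * ((1 - r * Real.cos φ)⁻¹ + f (r * Real.cos φ)) := by
    intro φ
    have hp := one_sub_mul_cos_pos h0 h1 φ
    rw [orbitRadius, hAf _ (hmem φ)]
    field_simp
    rw [hk']
  have hi1 : Continuous fun φ : ℝ => (1 - r * Real.cos φ)⁻¹ :=
    (by fun_prop : Continuous fun φ : ℝ => 1 - r * Real.cos φ).inv₀
      fun φ => (one_sub_mul_cos_pos h0 h1 φ).ne'
  have hi2 : Continuous fun φ : ℝ => f (r * Real.cos φ) := by fun_prop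
  simp only [heq]
  rw [intervalIntegral.integral_const_mul, intervalIntegral.integral_add
    (hi1.intervalIntegrable _ _) (hi2.intervalIntegrable _ _), integral_odd_comp_cos hf hodd,
    integral_inv_one_sub_mul_cos h0 h1, hd]
  field_simp
  simp

/-- The integrand equals (1 + y + (1 - y²) f(y))/√k with y = r cos φ, and all but the constant term
is odd in y. -/
lemma orbit_length {k : ℝ} (hk : 0 < k) {f : ℝ → ℝ} (hf : Continuous f)
    (hodd : ∀ y, f (-y) = -f y)
    (hAf : ∀ y ∈ Set.Icc (-1 : ℝ) 1, A ((1 - y) / k) = 1 + (1 - y) * f y)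
    {r : ℝ} (h0 : 0 ≤ r) (h1 : r < 1) :
    ∫ φ in (0 : ℝ)..(2 * Real.pi), (2 / orbitRadius k r φ - k) * timeDensity A k r φ =
      2 * Real.pi / √k := by
  have hkpos : 0 < √k := Real.sqrt_pos.2 hk
  have hmem : ∀ φ, r * Real.cos φ ∈ Set.Icc (-1 : ℝ) 1 := fun φ =>
    ⟨by nlinarith [Real.neg_one_le_cos φ], by nlinarith [Real.cos_le_one φ]⟩
  set g : ℝ → ℝ := fun y => (y + (1 - y ^ 2) * f y) / √k with hg
  have heq : ∀ φ, (2 / orbitRadius k r φ - k) * timeDensity A k r φ =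
      1 / √k + g (r * Real.cos φ) := by
    intro φ
    have hp := one_sub_mul_cos_pos h0 h1 φ
    rw [timeDensity, orbitRadius, hAf _ (hmem φ)]
    simp only [hg]
    field_simp
    ring
  have hgc : Continuous g := by fun_prop
  have hi : Continuous fun φ : ℝ => g (r * Real.cos φ) := by fun_prop
  simp only [heq]
  rw [intervalIntegral.integral_add (by simp) (hi.intervalIntegrable _ _),
    integral_odd_comp_cos hgc]
  · simp [div_eq_mul_inv]
  · intro y
    simp only [hg, hodd]; ring

lemma exists_int_of_unitVec_eq {x y : ℝ} (h : unitVec x = unitVec y) :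
    ∃ n : ℤ, x - y = n * (2 * Real.pi) := by
  have h0 := congrArg (fun v : Plane => v 0) h
  have h1 := congrArg (fun v : Plane => v 1) h
  simp only [unitVec_zero, unitVec_one] at h0 h1
  have : Real.cos (x - y) = 1 := by
    rw [Real.cos_sub, h0, h1]; linarith [Real.sin_sq_add_cos_sq y]
  obtain ⟨n, hn⟩ := (Real.cos_eq_one_iff _).1 this
  exact ⟨n, hn.symm⟩

/-- Orbits with nonzero angular momentum close up after one revolution. -/
lemma isClosedState_orbit (hA : Differentiable ℝ A) (hApos : ∀ ρ, 0 ≤ ρ → 0 < A ρ)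
    (hAβ : ∀ ρ, 0 < ρ → 1 + ρ ^ 2 * β (ρ ^ 2) = A ρ ^ 2) {k : ℝ} (hk : 0 < k)
    {f : ℝ → ℝ} (hf : Continuous f) (hodd : ∀ y, f (-y) = -f y)
    (hAf : ∀ y ∈ Set.Icc (-1 : ℝ) 1, A ((1 - y) / k) = 1 + (1 - y) * f y)
    {r ℓ : ℝ} (h0 : 0 ≤ r) (h1 : r < 1) (hℓ : k * ℓ ^ 2 = 1 - r ^ 2) (φ₀ θ₀ : ℝ) :
    IsClosedState (radialMetric β hβ hpos) keplerPotential (-k / 2) (2 * Real.pi / √k)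
      (polarPoint (orbitRadius k r φ₀) θ₀)
      (polarVelocity ℓ (orbitRadius k r φ₀) θ₀ (orbitMomentum A k r φ₀)) := by
  obtain ⟨ψ, hm, hc, e1, e2, hT, e4, e5⟩ := exists_eccentric_anomaly hA hApos hk h0 h1.le φ₀
  set T := ∫ x in (0 : ℝ)..(2 * Real.pi), timeDensity A k r x with hTdef
  have hψ0 : ψ 0 = φ₀ := by simpa using e1 φ₀
  have hkpos : 0 < √k := Real.sqrt_pos.2 hk
  have hρ := orbitRadius_pos hk h0 h1
  have hρc := continuous_orbitRadius k r
  have hℓ0 : ℓ ≠ 0 := by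
    rintro rfl
    nlinarith
  set j : ℝ → ℝ := fun φ => A (orbitRadius k r φ) / (orbitRadius k r φ * √k) with hj
  have hjpos : ∀ φ, 0 < j φ := fun φ => div_pos (hApos _ (hρ φ).le) (mul_pos (hρ φ) hkpos)
  have hjc : Continuous j := (hA.continuous.comp hρc).div (hρc.mul continuous_const)
    fun φ => (mul_pos (hρ φ) hkpos).ne'
  have hji : ∀ a b, IntervalIntegrable j MeasureTheory.volume a b := fun a b =>
    hjc.intervalIntegrable a b
  have hjper : Function.Periodic j (2 * Real.pi) := fun φ => by
    simp only [hj, orbitRadius_add_two_pi]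
  have hjint : ∀ a, ∫ φ in a..(a + 2 * Real.pi), j φ = 2 * Real.pi / |ℓ| := by
    intro a
    rw [hjper.intervalIntegral_add_eq a 0, zero_add]
    exact orbit_angle_period hk hf hodd hAf h0 h1 hℓ
  set Θ : ℝ → ℝ := fun t => θ₀ + ℓ * ∫ φ in φ₀..ψ t, j φ with hΘ
  have hΘder : ∀ t, HasDerivAt Θ (ℓ / orbitRadius k r (ψ t) ^ 2) t := by
    intro t
    have h2 : HasDerivAt (fun φ => ∫ x in φ₀..φ, j x) (j (ψ t)) (ψ t) :=
      intervalIntegral.integral_hasDerivAt_right (hji _ _)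
        hjc.aestronglyMeasurable.stronglyMeasurableAtFilter hjc.continuousAt
    have h3 := ((h2.comp t (e5 t (hρ _))).const_mul ℓ).const_add θ₀
    convert! h3 using 1
    have := hApos _ (hρ (ψ t)).le
    have h4 := hρ (ψ t)
    simp only [hj, timeDensity]
    field_simp
  have hmotion : IsMotion (lagrangian (radialMetric β hβ hpos) keplerPotential)
      (fun t => polarPoint (orbitRadius k r (ψ t)) (Θ t))
      (fun t => polarVelocity ℓ (orbitRadius k r (ψ t)) (Θ t) (orbitMomentum A k r (ψ t)))
      Set.univ :=
    isMotion_orbit hA hApos hAβ hk hℓ (fun t _ => hρ _) (fun t _ => e5 t (hρ _))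
      (fun t _ => hΘder t)
  have hψT : ψ T = φ₀ + 2 * Real.pi := by
    have := e4 0
    rwa [zero_add, hψ0] at this
  refine ⟨_, _, T, hmotion, ?_, ?_, hT, ?_, ?_, ?_⟩
  · simp [hψ0, hΘ]
  · simp [hψ0, hΘ]
  · intro t
    have h2 : Θ (t + T) = Θ t + ℓ / |ℓ| * (2 * Real.pi) := by
      have := intervalIntegral.integral_add_adjacent_intervals (hji φ₀ (ψ t))
        (hji (ψ t) (ψ t + 2 * Real.pi))
      simp only [hΘ, e4]
      rw [← this, hjint]
      ring
    have h3 : unitVec (Θ (t + T)) = unitVec (Θ t) := by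
      rw [h2]
      rcases lt_or_gt_of_ne hℓ0 with h | h
      · rw [abs_of_neg h, div_neg, div_self hℓ0, neg_one_mul, ← sub_eq_add_neg]
        simp [unitVec]
      · rw [abs_of_pos h, div_self hℓ0, one_mul]
        simp [unitVec]
    simp only [polarPoint, e4, orbitRadius_add_two_pi, h3]
  -- Minimality needs only the angle: before time T the orbit sweeps a positive angle less than 2π
  -- in absolute value, so it cannot return to its initial direction.
  · intro T' hT' hper
    by_contra hlt
    rw [not_le] at hlt
    have hp := hper 0
    rw [zero_add] at hp
    simp only [hψ0] at hp
    have hΘ0 : Θ 0 = θ₀ := by simp [hΘ, hψ0]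
    have hnorm := congrArg norm hp
    rw [norm_polarPoint (hρ _).le, norm_polarPoint (hρ _).le] at hnorm
    rw [polarPoint, polarPoint, hnorm, hΘ0] at hp
    obtain ⟨n, hn⟩ := exists_int_of_unitVec_eq (smul_right_injective _ (hρ φ₀).ne' hp)
    have hlow : φ₀ < ψ T' := hψ0 ▸ hm hT'
    have hupp : ψ T' < φ₀ + 2 * Real.pi := hψT ▸ hm hlt
    have hi1 : 0 < ∫ φ in φ₀..ψ T', j φ :=
      intervalIntegral.intervalIntegral_pos_of_pos (hji _ _) hjpos hlow
    have hi2 : 0 < ∫ φ in (ψ T')..(φ₀ + 2 * Real.pi), j φ :=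
      intervalIntegral.intervalIntegral_pos_of_pos (hji _ _) hjpos hupp
    have hi3 := intervalIntegral.integral_add_adjacent_intervals (hji φ₀ (ψ T'))
      (hji (ψ T') (φ₀ + 2 * Real.pi))
    rw [hjint] at hi3
    have hn' : |ℓ| * ∫ φ in φ₀..ψ T', j φ = |(n : ℝ)| * (2 * Real.pi) := by
      have h4 : ℓ * ∫ φ in φ₀..ψ T', j φ = n * (2 * Real.pi) := by
        rw [← hn]; simp [hΘ]
      have h5 := congrArg abs h4
      rwa [abs_mul, abs_mul, abs_of_pos hi1, abs_of_pos Real.two_pi_pos] at h5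
    have hℓp : 0 < |ℓ| := abs_pos.2 hℓ0
    have hn0 : 0 < |(n : ℝ)| := by
      have h6 := mul_pos hℓp hi1
      rw [hn'] at h6
      exact pos_of_mul_pos_left h6 Real.two_pi_pos.le
    have hn1 : |(n : ℝ)| < 1 := by
      have h7 : |ℓ| * ∫ φ in φ₀..ψ T', j φ < |ℓ| * (2 * Real.pi / |ℓ|) :=
        mul_lt_mul_of_pos_left (by linarith) hℓp
      rw [hn', mul_div_cancel₀ _ hℓp.ne'] at h7
      exact lt_of_mul_lt_mul_right (by simpa using h7) Real.two_pi_pos.le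
    rw [← Int.cast_abs] at hn0 hn1
    norm_cast at hn0 hn1
    omega
  -- On the energy shell g(v, v) = 2(e - V), so the Jacobi integrand is the root of a square, namely
  -- 2/ρ - k.
  · have hval : ∀ t, √(2 * (-k / 2 - keplerPotential (polarPoint (orbitRadius k r (ψ t)) (Θ t))) *
        (radialMetric β hβ hpos).inner (polarPoint (orbitRadius k r (ψ t)) (Θ t))
        (polarVelocity ℓ (orbitRadius k r (ψ t)) (Θ t) (orbitMomentum A k r (ψ t)))
        (polarVelocity ℓ (orbitRadius k r (ψ t)) (Θ t) (orbitMomentum A k r (ψ t)))) =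
        2 / orbitRadius k r (ψ t) - k := by
      intro t
      have h4 := hρ (ψ t)
      rw [radialMetric_polarVelocity h4, orbit_energy hApos hAβ hk hℓ h4, keplerPotential,
        norm_polarPoint h4.le]
      have h5 : 0 ≤ 2 / orbitRadius k r (ψ t) - k := by
        rw [sub_nonneg, le_div_iff₀ h4, orbitRadius, mul_div_cancel₀ _ hk.ne']
        nlinarith [Real.neg_one_le_cos (ψ t)]
      rw [← Real.sqrt_sq h5]
      congr 1
      field_simp
      ring
    rw [jacobiLength]
    simp only [hval]
    set G : ℝ → ℝ := fun φ => 2 / orbitRadius k r φ - k with hG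
    have hGc : Continuous G := (continuous_const.div hρc fun φ => (hρ φ).ne').sub continuous_const
    have hwc : Continuous (timeDensity A k r) :=
      ((hA.continuous.comp hρc).mul hρc).div_const _
    have hsub := intervalIntegral.integral_comp_mul_deriv (a := φ₀) (b := φ₀ + 2 * Real.pi)
      (f := fun φ => ∫ x in φ₀..φ, timeDensity A k r x) (f' := timeDensity A k r) (g := G ∘ ψ)
      (fun φ _ => intervalIntegral.integral_hasDerivAt_right (hwc.intervalIntegrable _ _)
        hwc.aestronglyMeasurable.stronglyMeasurableAtFilter hwc.continuousAt)
      hwc.continuousOn (hGc.comp hc)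
    have hwper : Function.Periodic (timeDensity A k r) (2 * Real.pi) := fun φ => by
      simp only [timeDensity, orbitRadius_add_two_pi]
    have hGper : Function.Periodic (fun φ => G φ * timeDensity A k r φ) (2 * Real.pi) := fun φ => by
      simp only [hG, timeDensity, orbitRadius_add_two_pi]
    rw [intervalIntegral.integral_same, hwper.intervalIntegral_add_eq φ₀ 0, zero_add, ← hTdef]
      at hsub
    simp only [Function.comp_apply, e1] at hsub
    rw [← hsub, hGper.intervalIntegral_add_eq φ₀ 0, zero_add]
    exact orbit_length hk hf hodd hAf h0 h1

/-- A rotationally invariant metric `A(ρ)² dρ² + ρ² dθ²` is Zoll for the Kepler potential at the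
energy `-k/2` when `(A(ρ) - 1) / (k ρ)` is an odd function of `y = 1 - k ρ`. -/
theorem isZoll_of_odd (hA : Differentiable ℝ A) (hApos : ∀ ρ, 0 ≤ ρ → 0 < A ρ)
    (hAβ : ∀ ρ, 0 < ρ → 1 + ρ ^ 2 * β (ρ ^ 2) = A ρ ^ 2) {k : ℝ} (hk : 0 < k)
    {f : ℝ → ℝ} (hf : Continuous f) (hodd : ∀ y, f (-y) = -f y)
    (hAf : ∀ y ∈ Set.Icc (-1 : ℝ) 1, A ((1 - y) / k) = 1 + (1 - y) * f y) :
    IsZoll (radialMetric β hβ hpos) keplerPotential (-k / 2) := by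
  refine ⟨2 * Real.pi / √k, fun q u hq he hcol => ?_⟩
  have hn : 0 < ‖q‖ := norm_pos_iff.2 hq
  have hkpos : 0 < √k := Real.sqrt_pos.2 hk
  have hk' : √k ^ 2 = k := Real.sq_sqrt hk.le
  obtain ⟨θ, ℓ, hq', hu'⟩ := eq_polar q u hq
  set ρ := ‖q‖ with hρ
  set c : ℝ := inner ℝ q u with hc
  have hAρ := hApos _ hn.le
  have hen : c ^ 2 * A ρ ^ 2 + ℓ ^ 2 = 2 * ρ - k * ρ ^ 2 := by
    rw [energy, hq', hu', radialMetric_polarVelocity hn, keplerPotential, norm_polarPoint hn.le,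
      hAβ _ hn] at he
    field_simp at he
    linear_combination he
  -- Energy conservation puts (1 - kρ, √k A c) on the circle of radius r = √(1 - kℓ²); its polar
  -- angle is the initial eccentric anomaly.
  have hsum : (1 - k * ρ) ^ 2 + (√k * A ρ * c) ^ 2 = 1 - k * ℓ ^ 2 := by
    rw [mul_pow, mul_pow, hk']; linear_combination k * hen
  obtain ⟨φ₀, h1, h2⟩ := exists_polar_angle (1 - k * ρ) (√k * A ρ * c)
  rw [hsum] at h1 h2
  set r := √(1 - k * ℓ ^ 2) with hr
  have hr2 : r ^ 2 = 1 - k * ℓ ^ 2 := Real.sq_sqrt (by rw [← hsum]; positivity)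
  have hrad : orbitRadius k r φ₀ = ρ := by
    rw [orbitRadius, h1]; field_simp; ring
  have hmom : orbitMomentum A k r φ₀ = c := by
    rw [orbitMomentum, hrad, h2]; field_simp
  rw [← hrad, ← hmom] at hu'
  rw [← hrad] at hq'
  have h0 : 0 ≤ r := Real.sqrt_nonneg _
  by_cases hℓ : ℓ = 0
  · have hr1 : r = 1 := by rw [hr, hℓ]; simp
    rw [hq', hu', hr1, hℓ] at hcol
    exact absurd (isCollisionState_radial hA hApos hAβ hk (by rw [← hr1, hrad]; exact hn) θ) hcol
  · have hr1 : r < 1 := by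
      have : 0 < k * ℓ ^ 2 := by positivity
      nlinarith
    rw [hq', hu']
    exact isClosedState_orbit hA hApos hAβ hk hf hodd hAf h0 hr1 (by linarith) φ₀ θ

end

/-! ### Extension by reflections to odd periodic functions -/

/-- The triangle wave of period `2 ξ` that equals `|x|` on `[-ξ, ξ]`. -/
def triangleWave (ξ x : ℝ) : ℝ := ξ / Real.pi * Real.arccos (Real.cos (Real.pi * x / ξ))

lemma continuous_triangleWave (ξ : ℝ) : Continuous (triangleWave ξ) := by
  unfold triangleWave
  exact continuous_const.mul (Real.continuous_arccos.comp (by fun_prop))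

lemma triangleWave_neg (ξ x : ℝ) : triangleWave ξ (-x) = triangleWave ξ x := by
  simp [triangleWave, neg_div]

lemma triangleWave_reflect {ξ : ℝ} (hξ : 0 < ξ) (x : ℝ) :
    triangleWave ξ (-2 * ξ - x) = triangleWave ξ x := by
  have : Real.pi * (-2 * ξ - x) / ξ = -(Real.pi * x / ξ + 2 * Real.pi) := by field_simp; ring
  rw [triangleWave, this, Real.cos_neg, Real.cos_add_two_pi, triangleWave]

lemma triangleWave_of_mem {ξ x : ℝ} (hξ : 0 < ξ) (hx : x ∈ Set.Icc (-ξ) 0) :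
    triangleWave ξ x = -x := by
  rw [← triangleWave_neg, triangleWave, Real.arccos_cos]
  · field_simp
  · exact div_nonneg (mul_nonneg Real.pi_pos.le (by linarith [hx.2])) hξ.le
  · rw [div_le_iff₀ hξ]
    exact mul_le_mul_of_nonneg_left (by linarith [hx.1]) Real.pi_pos.le

lemma pi_mul_triangleWave_div {ξ : ℝ} (hξ : 0 < ξ) (x : ℝ) :
    Real.pi * triangleWave ξ x / ξ = Real.arccos (Real.cos (Real.pi * x / ξ)) := by
  have := Real.pi_pos
  rw [triangleWave]; field_simp

lemma sin_pi_mul_triangleWave_div {ξ : ℝ} (hξ : 0 < ξ) (x : ℝ) :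
    Real.sin (Real.pi * triangleWave ξ x / ξ) = |Real.sin (Real.pi * x / ξ)| := by
  rw [pi_mul_triangleWave_div hξ, Real.sin_arccos, Real.abs_sin_eq_sqrt_one_sub_cos_sq]

lemma contDiffAt_triangleWave {ξ x : ℝ} (hξ : 0 < ξ) (h0 : triangleWave ξ x ≠ 0)
    (h1 : triangleWave ξ x ≠ ξ) : ContDiffAt ℝ ∞ (triangleWave ξ) x := by
  have hpi := Real.pi_pos
  unfold triangleWave at h0 h1 ⊢
  refine contDiffAt_const.mul ((Real.contDiffAt_arccos ?_ ?_).comp x ?_)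
  · intro h; rw [h, Real.arccos_neg_one] at h1
    exact h1 (by field_simp)
  · intro h; rw [h, Real.arccos_one] at h0
    exact h0 (by simp)
  · exact (Real.contDiff_cos.comp ((contDiff_const.mul contDiff_id).div_const _)).contDiffAt

/-- A subinterval `[α, γ]` of `(0, min ξ 1)`, where `ξ = h / κ - 1`, that contains no translate or
reflection of the collision point `1`. -/
structure Window (h κ : ℝ) where
  α : ℝ
  γ : ℝ
  κ_pos : 0 < κ
  κ_lt : κ < h
  α_pos : 0 < α
  α_lt : α < γ
  γ_lt : γ < h / κ - 1
  γ_lt_one : γ < 1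
  avoids : triangleWave (h / κ - 1) 1 ∉ Set.Icc α γ

lemma nonempty_window {h κ : ℝ} (hκ : 0 < κ) (hh : κ < h) : Nonempty (Window h κ) := by
  have hξ : 0 < h / κ - 1 := by rw [sub_pos, lt_div_iff₀ hκ]; linarith
  set m := min (h / κ - 1) 1 with hm
  have hm0 : 0 < m := lt_min hξ one_pos
  have h1 : m ≤ h / κ - 1 := min_le_left _ _
  have h2 : m ≤ 1 := min_le_right _ _
  -- Only one point has to be avoided, so one of the disjoint intervals [m/8, m/4] and [m/2, 3m/4]
  -- will do.
  by_cases hw : triangleWave (h / κ - 1) 1 < m / 2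
  · exact ⟨⟨m / 2, 3 * m / 4, hκ, hh, by linarith, by linarith, by linarith, by linarith,
      fun h => by linarith [h.1]⟩⟩
  · exact ⟨⟨m / 8, m / 4, hκ, hh, by linarith, by linarith, by linarith, by linarith,
      fun h => by linarith [h.2]⟩⟩

/-- Smooth functions with values in `[-1, 1]` that vanish outside `(0, 1)`. -/
structure IsProfile (p : ℝ → ℝ) : Prop where
  smooth : ContDiff ℝ ∞ p
  zero : ∀ s, s ∉ Set.Ioo (0 : ℝ) 1 → p s = 0
  bound : ∀ s, |p s| ≤ 1

namespace Window
variable {h κ : ℝ} (W : Window h κ)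

lemma xi_pos (W : Window h κ) : 0 < h / κ - 1 := by
  rw [sub_pos, lt_div_iff₀ W.κ_pos]; linarith [W.κ_lt]

lemma h_pos (W : Window h κ) : 0 < h := W.κ_pos.trans W.κ_lt

/-- The size of the deformations. -/
def size : ℝ := (1 - W.γ ^ 2) / (2 * (h * (2 / κ + 1)))

lemma one_sub_sq_pos {y : ℝ} (hy : y ∈ Set.Icc W.α W.γ) : 0 < 1 - y ^ 2 := by
  nlinarith [W.α_pos, W.γ_lt_one, hy.1, hy.2]

lemma one_sub_γ_sq_pos : 0 < 1 - W.γ ^ 2 := W.one_sub_sq_pos ⟨W.α_lt.le, le_rfl⟩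

lemma scale_pos (W : Window h κ) : 0 < h * (2 / κ + 1) := by
  have := W.h_pos
  have := W.κ_pos
  positivity

lemma size_pos : 0 < W.size :=
  div_pos W.one_sub_γ_sq_pos (mul_pos two_pos W.scale_pos)

/-- The rescaled profile, up to the weight that turns deformation functions into odd periodic
functions. -/
def weighted (p : ℝ → ℝ) (y : ℝ) : ℝ :=
  -W.size * p ((W.γ - y) / (W.γ - W.α)) / (Real.sin (Real.pi * y / (h / κ - 1)) * (1 - y ^ 2))

lemma rescale_notMem {y : ℝ} (hy : y ∉ Set.Ioo W.α W.γ) :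
    (W.γ - y) / (W.γ - W.α) ∉ Set.Ioo (0 : ℝ) 1 := by
  have hd : 0 < W.γ - W.α := sub_pos.2 W.α_lt
  rintro ⟨h1, h2⟩
  rw [div_pos_iff_of_pos_right hd] at h1
  rw [div_lt_one hd] at h2
  exact hy ⟨by linarith, by linarith⟩

lemma weighted_eq_zero {p : ℝ → ℝ} (hp : ∀ s, s ∉ Set.Ioo (0 : ℝ) 1 → p s = 0) {y : ℝ}
    (hy : y ∉ Set.Ioo W.α W.γ) : W.weighted p y = 0 := by
  rw [weighted, hp _ (W.rescale_notMem hy)]; simp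

/-- The odd `2 ξ`-periodic function `F(x) / (1 - x²)`, where `F` is the deformation function. -/
def oddPart (p : ℝ → ℝ) (x : ℝ) : ℝ :=
  Real.sin (Real.pi * x / (h / κ - 1)) * W.weighted p (triangleWave (h / κ - 1) x)

lemma oddPart_neg (p : ℝ → ℝ) (x : ℝ) : W.oddPart p (-x) = -W.oddPart p x := by
  simp [oddPart, triangleWave_neg, neg_div]

lemma oddPart_reflect (p : ℝ → ℝ) (x : ℝ) :
    W.oddPart p (-2 * (h / κ - 1) - x) = -W.oddPart p x := by
  have hξ := W.xi_pos
  rw [oddPart, triangleWave_reflect hξ, oddPart]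
  set ξ := h / κ - 1
  have : Real.pi * (-2 * ξ - x) / ξ = -(Real.pi * x / ξ + 2 * Real.pi) := by field_simp; ring
  rw [this, Real.sin_neg, Real.sin_add_two_pi]; ring

lemma sin_pos {y : ℝ} (hy : y ∈ Set.Icc W.α W.γ) :
    0 < Real.sin (Real.pi * y / (h / κ - 1)) := by
  have hξ := W.xi_pos
  have hy0 : 0 < y := W.α_pos.trans_le hy.1
  apply Real.sin_pos_of_pos_of_lt_pi
  · exact div_pos (mul_pos Real.pi_pos hy0) hξ
  · rw [div_lt_iff₀ hξ]
    exact mul_lt_mul_of_pos_left (hy.2.trans_lt W.γ_lt) Real.pi_pos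

/-- The sine in front and the sine in the denominator of `weighted` agree up to sign. What remains
is at most `size`/(1 - γ²), and `size` is chosen to make this the stated bound. -/
lemma abs_oddPart_le {p : ℝ → ℝ} (hp : IsProfile p) (x : ℝ) :
    |W.oddPart p x| ≤ 1 / (2 * (h * (2 / κ + 1))) := by
  have hM := W.scale_pos
  set y := triangleWave (h / κ - 1) x with hy
  by_cases hmem : y ∈ Set.Ioo W.α W.γ
  · have hmem' := Set.Ioo_subset_Icc_self hmem
    have hs := W.sin_pos hmem'
    have h1 := W.one_sub_sq_pos hmem'
    have hγ := W.one_sub_γ_sq_pos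
    have hsin : Real.sin (Real.pi * y / (h / κ - 1)) = |Real.sin (Real.pi * x / (h / κ - 1))| :=
      sin_pi_mul_triangleWave_div W.xi_pos x
    have hle : 1 - W.γ ^ 2 ≤ 1 - y ^ 2 := by nlinarith [hmem.1, hmem.2, W.α_pos]
    rw [oddPart, ← hy, weighted, abs_mul, abs_div, abs_mul, abs_mul, ← hsin, abs_of_pos hs,
      abs_of_pos h1, abs_neg, abs_of_pos W.size_pos]
    have hb := hp.bound ((W.γ - y) / (W.γ - W.α))
    set q := |p ((W.γ - y) / (W.γ - W.α))|
    have hq : 0 ≤ q := abs_nonneg _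
    rw [size]
    field_simp
    gcongr
    nlinarith
  · rw [oddPart, W.weighted_eq_zero hp.zero hmem]
    simp only [mul_zero, abs_zero]
    positivity

/-- On [-ξ, 0] the triangle wave is -x and the sine is nonpositive; the minus sign and the reversed
rescaling in `weighted` compensate for this. -/
lemma oddPart_of_mem {p : ℝ → ℝ} (hp : ∀ s, s ∉ Set.Ioo (0 : ℝ) 1 → p s = 0) {x : ℝ}
    (hx : x ∈ Set.Icc (-(h / κ - 1)) 0) :
    (1 - x ^ 2) * W.oddPart p x = W.size * p ((x + W.γ) / (W.γ - W.α)) := by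
  rw [oddPart, triangleWave_of_mem W.xi_pos hx]
  by_cases hmem : -x ∈ Set.Ioo W.α W.γ
  · have hs := W.sin_pos (Set.Ioo_subset_Icc_self hmem)
    have h1 := W.one_sub_sq_pos (Set.Ioo_subset_Icc_self hmem)
    rw [neg_sq] at h1
    have e1 : Real.sin (Real.pi * x / (h / κ - 1)) =
        -Real.sin (Real.pi * -x / (h / κ - 1)) := by
      rw [← Real.sin_neg]; congr 1; ring
    rw [weighted, e1, neg_sq, sub_neg_eq_add, add_comm W.γ x]
    set S := Real.sin (Real.pi * -x / (h / κ - 1))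
    field_simp
  · have h2 := W.rescale_notMem hmem
    rw [sub_neg_eq_add, add_comm W.γ x] at h2
    rw [W.weighted_eq_zero hp hmem, hp _ h2]; ring

lemma eventually_oddPart_eq_zero {E : Type*} {P : E → ℝ → ℝ}
    (hP0 : ∀ e s, s ∉ Set.Ioo (0 : ℝ) 1 → P e s = 0) {x : ℝ}
    (hx : triangleWave (h / κ - 1) x ∉ Set.Icc W.α W.γ) :
    ∀ᶠ x' in nhds x, ∀ e, W.oddPart (P e) x' = 0 := by
  have hopen : IsOpen {x' | triangleWave (h / κ - 1) x' ∉ Set.Icc W.α W.γ} :=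
    isClosed_Icc.isOpen_compl.preimage (continuous_triangleWave _)
  filter_upwards [hopen.mem_nhds hx] with x' hx' e
  rw [oddPart, W.weighted_eq_zero (hP0 e) fun hm => hx' (Set.Ioo_subset_Icc_self hm), mul_zero]

section smooth
variable {E : Type*} [NormedAddCommGroup E] [NormedSpace ℝ E] {P : E → ℝ → ℝ}

/-- The corners of the triangle wave, at the values 0 and ξ, lie outside [α, γ], where the function
vanishes locally. Over [α, γ] the wave is smooth and the denominator is nonzero. The parameter e is
carried along for the smoothness of families of metrics. -/
lemma contDiff_oddPart (hP : ContDiff ℝ ∞ fun z : E × ℝ => P z.1 z.2)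
    (hP0 : ∀ e s, s ∉ Set.Ioo (0 : ℝ) 1 → P e s = 0) :
    ContDiff ℝ ∞ fun z : E × ℝ => W.oddPart (P z.1) z.2 := by
  rw [contDiff_iff_contDiffAt]
  rintro ⟨e, x⟩
  by_cases hx : triangleWave (h / κ - 1) x ∈ Set.Icc W.α W.γ
  · have ht : ContDiffAt ℝ ∞ (fun z : E × ℝ => triangleWave (h / κ - 1) z.2) (e, x) := by
      refine ContDiffAt.comp (g := triangleWave (h / κ - 1)) (f := fun z : E × ℝ => z.2) (e, x)
        (contDiffAt_triangleWave W.xi_pos ?_ ?_) contDiffAt_snd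
      · exact (W.α_pos.trans_le hx.1).ne'
      · exact (hx.2.trans_lt W.γ_lt).ne
    have hs : ContDiffAt ℝ ∞ (fun z : E × ℝ => Real.sin (Real.pi * z.2 / (h / κ - 1))) (e, x) :=
      (Real.contDiff_sin.comp ((contDiff_const.mul contDiff_snd).div_const _)).contDiffAt
    unfold oddPart weighted
    refine hs.mul ((contDiffAt_const.mul ?_).div ?_ ?_)
    · exact ContDiffAt.comp (g := fun z : E × ℝ => P z.1 z.2)
        (f := fun z : E × ℝ => (z.1, (W.γ - triangleWave (h / κ - 1) z.2) / (W.γ - W.α)))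
        (e, x) hP.contDiffAt (contDiffAt_fst.prodMk ((contDiffAt_const.sub ht).div_const _))
    · exact (Real.contDiff_sin.contDiffAt.comp _ ((contDiffAt_const.mul ht).div_const _)).mul
        (contDiffAt_const.sub (ht.pow 2))
    · exact mul_ne_zero (W.sin_pos hx).ne' (W.one_sub_sq_pos hx).ne'
  · refine (contDiffAt_const (c := (0 : ℝ))).congr_of_eventuallyEq ?_
    have h1 := W.eventually_oddPart_eq_zero hP0 hx
    have h2 : Filter.Tendsto (fun z : E × ℝ => z.2) (nhds (e, x)) (nhds x) :=
      continuous_snd.tendsto (e, x)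
    filter_upwards [h2.eventually h1] with z hz using hz z.1

end smooth

/-! ### The deformed metrics and their Zoll property -/

/-- The square root of the radial coefficient of the deformed metric. -/
def radialFactor (p : ℝ → ℝ) (ρ : ℝ) : ℝ :=
  1 + h * ρ * (1 - Real.smoothTransition (ρ - 2 / κ)) * W.oddPart p (1 - h * ρ)

lemma radialFactor_of_le (p : ℝ → ℝ) {ρ : ℝ} (hρ : ρ ≤ 2 / κ) :
    W.radialFactor p ρ = 1 + h * ρ * W.oddPart p (1 - h * ρ) := by
  rw [radialFactor, Real.smoothTransition.zero_of_nonpos (by linarith)]; ring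

/-- The cutoff confines the deformation to ρ ≤ 2/κ + 1. There the factor hρ is at most h(2/κ + 1),
so A differs from 1 by at most 1/2. -/
lemma radialFactor_pos {p : ℝ → ℝ} (hp : IsProfile p) {ρ : ℝ} (hρ : 0 ≤ ρ) :
    0 < W.radialFactor p ρ := by
  have hM := W.scale_pos
  have hh := W.h_pos
  have h1 := W.abs_oddPart_le hp (1 - h * ρ)
  have h2 : |h * ρ * (1 - Real.smoothTransition (ρ - 2 / κ))| ≤ h * (2 / κ + 1) := by
    have h3 := Real.smoothTransition.nonneg (ρ - 2 / κ)
    have h4 := Real.smoothTransition.le_one (ρ - 2 / κ)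
    rw [abs_of_nonneg (mul_nonneg (by positivity) (by linarith))]
    rcases le_total ρ (2 / κ + 1) with hl | hl
    · calc h * ρ * (1 - Real.smoothTransition (ρ - 2 / κ)) ≤ h * ρ * 1 :=
            mul_le_mul_of_nonneg_left (by linarith) (by positivity)
        _ ≤ h * (2 / κ + 1) := by rw [mul_one]; exact mul_le_mul_of_nonneg_left hl hh.le
    · rw [Real.smoothTransition.one_of_one_le (by linarith)]
      simpa using hM.le
  have h5 : |h * ρ * (1 - Real.smoothTransition (ρ - 2 / κ)) * W.oddPart p (1 - h * ρ)| ≤ 1 / 2 := by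
    rw [abs_mul]
    calc _ ≤ h * (2 / κ + 1) * (1 / (2 * (h * (2 / κ + 1)))) :=
          mul_le_mul h2 h1 (abs_nonneg _) hM.le
      _ = 1 / 2 := by rw [mul_one_div, mul_comm 2, div_mul_cancel_left₀ hM.ne', one_div]
  have := (abs_le.1 h5).1
  rw [radialFactor]; linarith

/-- The coefficient of the deformed metric, as a function of `|x|²`. -/
def coeff (p : ℝ → ℝ) (s : ℝ) : ℝ := (W.radialFactor p √s ^ 2 - 1) / s

lemma one_add_mul_coeff (p : ℝ → ℝ) {s : ℝ} (hs : 0 < s) :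
    1 + s * W.coeff p s = W.radialFactor p √s ^ 2 := by
  rw [coeff]; field_simp; ring

lemma one_add_sq_mul_coeff (p : ℝ → ℝ) {ρ : ℝ} (hρ : 0 < ρ) :
    1 + ρ ^ 2 * W.coeff p (ρ ^ 2) = W.radialFactor p ρ ^ 2 := by
  rw [W.one_add_mul_coeff p (by positivity), Real.sqrt_sq hρ.le]

lemma one_add_mul_coeff_pos {p : ℝ → ℝ} (hp : IsProfile p) (s : ℝ) (hs : 0 ≤ s) :
    0 < 1 + s * W.coeff p s := by
  rcases hs.eq_or_lt with rfl | hs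
  · simp
  · rw [W.one_add_mul_coeff p hs]
    exact pow_pos (W.radialFactor_pos hp (Real.sqrt_nonneg s)) 2

section smooth
variable {E : Type*} [NormedAddCommGroup E] [NormedSpace ℝ E] {P : E → ℝ → ℝ}

lemma contDiff_radialFactor (hP : ContDiff ℝ ∞ fun z : E × ℝ => P z.1 z.2)
    (hP0 : ∀ e s, s ∉ Set.Ioo (0 : ℝ) 1 → P e s = 0) :
    ContDiff ℝ ∞ fun z : E × ℝ => W.radialFactor (P z.1) z.2 := by
  unfold radialFactor
  have h1 : ContDiff ℝ ∞ fun z : E × ℝ => h * z.2 := contDiff_const.mul contDiff_snd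
  refine contDiff_const.add ((h1.mul (contDiff_const.sub ?_)).mul ?_)
  · exact Real.smoothTransition.contDiff.comp (contDiff_snd.sub contDiff_const)
  · exact ContDiff.comp (g := fun z : E × ℝ => W.oddPart (P z.1) z.2)
      (f := fun z : E × ℝ => (z.1, 1 - h * z.2)) (W.contDiff_oddPart hP hP0)
      (contDiff_fst.prodMk (contDiff_const.sub h1))

lemma contDiff_coeff (hP : ContDiff ℝ ∞ fun z : E × ℝ => P z.1 z.2)
    (hP0 : ∀ e s, s ∉ Set.Ioo (0 : ℝ) 1 → P e s = 0) :
    ContDiff ℝ ∞ fun z : E × ℝ => W.coeff (P z.1) z.2 := by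
  rw [contDiff_iff_contDiffAt]
  rintro ⟨e, s⟩
  by_cases hs : 0 < s
  · have h1 : ContDiffAt ℝ ∞ (fun z : E × ℝ => √z.2) (e, s) :=
      ContDiffAt.sqrt contDiffAt_snd hs.ne'
    have h2 := ContDiffAt.comp (g := fun z : E × ℝ => W.radialFactor (P z.1) z.2)
      (f := fun z : E × ℝ => (z.1, √z.2)) (e, s) (W.contDiff_radialFactor hP hP0).contDiffAt
      (contDiffAt_fst.prodMk h1)
    exact ((h2.pow 2).sub contDiffAt_const).div contDiffAt_snd hs.ne'
  -- For s ≤ 0 the real square root is 0, so nearby arguments 1 - h√s are close to 1, where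
  -- `oddPart` vanishes by `avoids`. The coefficient is then 0, also at s = 0 since 0/0 = 0.
  · refine (contDiffAt_const (c := (0 : ℝ))).congr_of_eventuallyEq ?_
    have h1 := W.eventually_oddPart_eq_zero hP0 W.avoids
    have hc : Continuous fun z : E × ℝ => 1 - h * √z.2 := by fun_prop
    have h2 : Filter.Tendsto (fun z : E × ℝ => 1 - h * √z.2) (nhds (e, s)) (nhds 1) := by
      have := hc.tendsto (e, s)
      simpa [Real.sqrt_eq_zero_of_nonpos (not_lt.1 hs)] using this
    filter_upwards [h2.eventually h1] with z hz
    simp [coeff, radialFactor, hz]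

end smooth

lemma contDiff_oddPart_single {p : ℝ → ℝ} (hp : IsProfile p) : ContDiff ℝ ∞ (W.oddPart p) :=
  ContDiff.comp (g := fun z : ℝ × ℝ => W.oddPart p z.2) (f := fun x : ℝ => ((0 : ℝ), x))
    (W.contDiff_oddPart (P := fun _ : ℝ => p) (hp.smooth.comp contDiff_snd) fun _ => hp.zero)
    (contDiff_const.prodMk contDiff_id)

lemma contDiff_radialFactor_single {p : ℝ → ℝ} (hp : IsProfile p) :
    ContDiff ℝ ∞ (W.radialFactor p) :=
  ContDiff.comp (g := fun z : ℝ × ℝ => W.radialFactor p z.2) (f := fun x : ℝ => ((0 : ℝ), x))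
    (W.contDiff_radialFactor (P := fun _ : ℝ => p) (hp.smooth.comp contDiff_snd) fun _ => hp.zero)
    (contDiff_const.prodMk contDiff_id)

lemma contDiff_coeff_single {p : ℝ → ℝ} (hp : IsProfile p) : ContDiff ℝ ∞ (W.coeff p) :=
  ContDiff.comp (g := fun z : ℝ × ℝ => W.coeff p z.2) (f := fun x : ℝ => ((0 : ℝ), x))
    (W.contDiff_coeff (P := fun _ : ℝ => p) (hp.smooth.comp contDiff_snd) fun _ => hp.zero)
    (contDiff_const.prodMk contDiff_id)

/-- The deformed metric. -/
def metric {p : ℝ → ℝ} (hp : IsProfile p) : RotMetric :=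
  radialMetric (W.coeff p) (W.contDiff_coeff_single hp) (W.one_add_mul_coeff_pos hp)

lemma metric_mem_zollMetrics {p : ℝ → ℝ} (hp : IsProfile p) : W.metric hp ∈ zollMetrics h κ := by
  have hA := (W.contDiff_radialFactor_single hp).differentiable (by simp)
  have hc := (W.contDiff_oddPart_single hp).continuous
  have hκ := W.κ_pos
  have hh := W.h_pos
  constructor
  -- At energy -κ/2 the variable is y = 1 - κρ, with x = 1 - (h/κ)(1 - y). The reflection y ↦ -y
  -- becomes x ↦ -2ξ - x.
  · refine isZoll_of_odd hA (fun ρ => W.radialFactor_pos hp) (fun ρ => W.one_add_sq_mul_coeff p)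
      hκ (f := fun y => h / κ * W.oddPart p (1 - h / κ * (1 - y))) (by fun_prop) ?_ ?_
    · intro y
      have : 1 - h / κ * (1 - -y) = -2 * (h / κ - 1) - (1 - h / κ * (1 - y)) := by ring
      rw [this, W.oddPart_reflect]; ring
    · intro y hy
      rw [W.radialFactor_of_le p (div_le_div_of_nonneg_right (by linarith [hy.1]) hκ.le)]
      have : h * ((1 - y) / κ) = h / κ * (1 - y) := by ring
      rw [this]; ring
  · refine isZoll_of_odd hA (fun ρ => W.radialFactor_pos hp) (fun ρ => W.one_add_sq_mul_coeff p)
      hh hc (W.oddPart_neg p) ?_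
    intro y hy
    -- The Hill region of the lower energy lies inside the other one, so the cutoff is inactive
    -- there too.
    have h1 : (1 - y) / h ≤ 2 / κ :=
      div_le_div₀ two_pos.le (by linarith [hy.1]) hκ W.κ_lt.le
    have h2 : h * ((1 - y) / h) = 1 - y := by field_simp
    rw [W.radialFactor_of_le p h1, h2, sub_sub_cancel]

lemma norm_le_of_mem_hillUnion (W : Window h κ) {x : Plane} (hx : x ∈ hillUnion h κ) :
    x ≠ 0 ∧ ‖x‖ ≤ 2 / κ := by
  have hκ := W.κ_pos
  have key : ∀ k, κ ≤ k → x ∈ hillRegion keplerPotential (-k / 2) → x ≠ 0 ∧ ‖x‖ ≤ 2 / κ := by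
    rintro k hk ⟨h0, h1⟩
    have hn : 0 < ‖x‖ := norm_pos_iff.2 h0
    refine ⟨h0, ?_⟩
    rw [keplerPotential] at h1
    have h2 : k / 2 ≤ 1 / ‖x‖ := by linarith
    rw [le_div_iff₀ hn] at h2
    rw [le_div_iff₀ hκ]
    nlinarith
  rcases hx with hx | hx
  · exact key κ le_rfl hx
  · exact key h W.κ_lt.le hx

lemma hasDeformationFunction {p : ℝ → ℝ} (hp : IsProfile p) :
    HasDeformationFunction h κ (W.metric hp) fun x => (1 - x ^ 2) * W.oddPart p x := by
  refine ⟨W.radialFactor p, fun ρ h0 h1 => ⟨W.radialFactor_pos hp h0.le, ?_⟩, ?_⟩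
  -- With x = 1 - hρ one has 1 - x² = hρ(2 - hρ).
  · rw [W.radialFactor_of_le p h1]; ring
  · intro x hx u w
    have hn : 0 < ‖x‖ := norm_pos_iff.2 (W.norm_le_of_mem_hillUnion hx).1
    rw [metric, radialMetric_inner, ← W.one_add_sq_mul_coeff p hn, dRho, dRho, dTheta, dTheta,
      plane_inner, plane_inner, plane_inner]
    have h2 := plane_norm_sq x
    field_simp
    rw [h2]
    ring

lemma reflectionLaws (p : ℝ → ℝ) :
    ReflectionLaws (h / κ - 1) fun x => (1 - x ^ 2) * W.oddPart p x := by
  refine ⟨fun x _ => ?_, fun x _ => ?_⟩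
  · simp only [W.oddPart_neg]; ring
  · simp only [W.oddPart_reflect]; ring

/-! ### Recovering the profile from the metric -/

/-- A point at which the metric sees the value of the profile at `s`. -/
def probeRadius (s : ℝ) : ℝ := (1 + W.γ - (W.γ - W.α) * s) / h

lemma probe_mem {s : ℝ} (hs : s ∈ Set.Ioo (0 : ℝ) 1) :
    -W.γ + (W.γ - W.α) * s ∈ Set.Ioo (-W.γ) (-W.α) := by
  have hd : 0 < W.γ - W.α := sub_pos.2 W.α_lt
  constructor <;> nlinarith [hs.1, hs.2]

lemma probeRadius_pos {s : ℝ} (hs : s ∈ Set.Ioo (0 : ℝ) 1) : 0 < W.probeRadius s := by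
  have := W.probe_mem hs
  exact div_pos (by linarith [this.2, W.α_pos]) W.h_pos

lemma probeRadius_le {s : ℝ} (hs : s ∈ Set.Ioo (0 : ℝ) 1) : W.probeRadius s ≤ 2 / κ := by
  have := W.probe_mem hs
  exact div_le_div₀ two_pos.le (by linarith [this.1, W.γ_lt_one]) W.κ_pos W.κ_lt.le

lemma probe_mem_hillUnion {s : ℝ} (hs : s ∈ Set.Ioo (0 : ℝ) 1) :
    polarPoint (W.probeRadius s) 0 ∈ hillUnion h κ := by
  have h0 := W.probeRadius_pos hs
  have h1 := W.probeRadius_le hs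
  refine Or.inl ⟨?_, ?_⟩
  · rw [← norm_ne_zero_iff, norm_polarPoint h0.le]; exact h0.ne'
  · rw [keplerPotential, norm_polarPoint h0.le]
    have : κ / 2 ≤ 1 / W.probeRadius s := by
      rw [le_div_iff₀ W.κ_pos] at h1
      rw [le_div_iff₀ h0]; linarith
    linarith

/-- The sensitivity of the radial factor at the probing point to the value of the profile. -/
def sensitivity (s : ℝ) : ℝ := W.size / (1 - W.γ + (W.γ - W.α) * s)

lemma sensitivity_pos {s : ℝ} (hs : s ∈ Set.Ioo (0 : ℝ) 1) : 0 < W.sensitivity s :=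
  div_pos W.size_pos (by linarith [(W.probe_mem hs).1, W.γ_lt_one])

lemma radialFactor_probe {p : ℝ → ℝ} (hp : IsProfile p) {s : ℝ} (hs : s ∈ Set.Ioo (0 : ℝ) 1) :
    W.radialFactor p (W.probeRadius s) = 1 + W.sensitivity s * p s := by
  have hm := W.probe_mem hs
  have hh := W.h_pos
  have hd : W.γ - W.α ≠ 0 := (sub_pos.2 W.α_lt).ne'
  rw [W.radialFactor_of_le p (W.probeRadius_le hs)]
  have h1 : h * W.probeRadius s = 1 - (-W.γ + (W.γ - W.α) * s) := by
    rw [probeRadius]; field_simp; ring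
  have h2 := W.oddPart_of_mem hp.zero (x := -W.γ + (W.γ - W.α) * s)
    ⟨by linarith [hm.1, W.γ_lt], by linarith [hm.2, W.α_pos]⟩
  have h3 : (-W.γ + (W.γ - W.α) * s + W.γ) / (W.γ - W.α) = s := by field_simp; ring
  rw [h3] at h2
  rw [h1, sub_sub_cancel]
  have h4 : 0 < 1 - W.γ + (W.γ - W.α) * s := by linarith [hm.1, W.γ_lt_one]
  rw [sensitivity]
  field_simp
  linear_combination h2

/-- Evaluating on the radial vector isolates A², hence the value of the profile at s. -/
lemma metric_probe {p : ℝ → ℝ} (hp : IsProfile p) {s : ℝ} (hs : s ∈ Set.Ioo (0 : ℝ) 1) :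
    (W.metric hp).inner (polarPoint (W.probeRadius s) 0) (polarPoint (W.probeRadius s) 0)
      (polarPoint (W.probeRadius s) 0) =
      W.probeRadius s ^ 2 * (1 + W.sensitivity s * p s) ^ 2 := by
  have h0 := W.probeRadius_pos hs
  rw [metric, radialMetric_inner, real_inner_self_eq_norm_sq, norm_polarPoint h0.le,
    ← W.radialFactor_probe hp hs, ← W.one_add_sq_mul_coeff p h0]
  ring

lemma one_add_sensitivity_pos {p : ℝ → ℝ} (hp : IsProfile p) {s : ℝ}
    (hs : s ∈ Set.Ioo (0 : ℝ) 1) : 0 < 1 + W.sensitivity s * p s := by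
  rw [← W.radialFactor_probe hp hs]
  exact W.radialFactor_pos hp (W.probeRadius_pos hs).le

lemma profile_eq_of_equivOn {p p' : ℝ → ℝ} (hp : IsProfile p) (hp' : IsProfile p')
    (he : EquivOn (hillUnion h κ) (W.metric hp) (W.metric hp')) : p = p' := by
  funext s
  by_cases hs : s ∈ Set.Ioo (0 : ℝ) 1
  · have h1 := W.metric_probe hp hs
    rw [he _ (W.probe_mem_hillUnion hs), W.metric_probe hp' hs] at h1
    have h2 := mul_left_cancel₀ (pow_pos (W.probeRadius_pos hs) 2).ne' h1
    -- The metric only determines A²; positivity of A permits taking the root.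
    have h3 := (pow_left_inj₀ (W.one_add_sensitivity_pos hp' hs).le
      (W.one_add_sensitivity_pos hp hs).le two_ne_zero).1 h2
    exact mul_left_cancel₀ (W.sensitivity_pos hs).ne' (by linarith)
  · rw [hp.zero s hs, hp'.zero s hs]

end Window

/-! ### Finite-dimensional families and the embedding -/

/-- The diffeomorphism `z ↦ z / √(1 + z²)` from the line to `(-1, 1)`. -/
def squash (z : ℝ) : ℝ := z / √(1 + z ^ 2)

lemma contDiff_squash : ContDiff ℝ ∞ squash := by
  have h : ∀ z : ℝ, 0 < 1 + z ^ 2 := fun z => by positivity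
  exact contDiff_id.div ((contDiff_const.add (contDiff_id.pow 2)).sqrt fun z => (h z).ne')
    fun z => (Real.sqrt_pos.2 (h z)).ne'

lemma abs_squash_le (z : ℝ) : |squash z| ≤ 1 := by
  have h : 0 < √(1 + z ^ 2) := Real.sqrt_pos.2 (by positivity)
  rw [squash, abs_div, abs_of_pos h, div_le_one h]
  exact Real.abs_le_sqrt (by linarith)

lemma squash_zero : squash 0 = 0 := by simp [squash]

lemma hasDerivAt_squash (z : ℝ) : HasDerivAt squash ((1 + z ^ 2) * √(1 + z ^ 2))⁻¹ z := by
  have h : 0 < 1 + z ^ 2 := by positivity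
  have hs : 0 < √(1 + z ^ 2) := Real.sqrt_pos.2 h
  have hd := (hasDerivAt_id z).div ((((hasDerivAt_pow 2 z).const_add 1)).sqrt h.ne') hs.ne'
  convert! hd using 1
  have h2 : √(1 + z ^ 2) ^ 2 = 1 + z ^ 2 := Real.sq_sqrt h.le
  simp only [id]
  field_simp
  rw [h2]; push_cast; ring

lemma squash_injective : Function.Injective squash := by
  refine (strictMono_of_deriv_pos fun z => ?_).injective
  rw [(hasDerivAt_squash z).deriv]
  have : 0 < √(1 + z ^ 2) := Real.sqrt_pos.2 (by positivity)
  positivity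

lemma isProfile_squash_comp {f : ℝ → ℝ} (hf : ContDiff ℝ ∞ f)
    (h0 : ∀ s, s ∉ Set.Ioo (0 : ℝ) 1 → f s = 0) : IsProfile fun s => squash (f s) where
  smooth := contDiff_squash.comp hf
  zero s hs := by rw [h0 s hs, squash_zero]
  bound _ := abs_squash_le _

/-- Bumps in `(0, 1)`, each equal to one at its center and vanishing at the centers of the
others. -/
lemma exists_dual_bumps (n : ℕ) : ∃ (φ : Fin n → ℝ → ℝ) (t : Fin n → ℝ),
    (∀ i, ContDiff ℝ ∞ (φ i)) ∧ (∀ i s, s ∉ Set.Ioo (0 : ℝ) 1 → φ i s = 0) ∧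
    (∀ i, t i ∈ Set.Ioo (0 : ℝ) 1) ∧ ∀ i j, φ i (t j) = if i = j then 1 else 0 := by
  have hn : (0 : ℝ) < n + 1 := by positivity
  set t : Fin n → ℝ := fun i => ((i : ℝ) + 1) / (n + 1) with ht
  -- The outer radius equals the spacing of the centers and their least distance to 0 and 1.
  set b : ∀ i, ContDiffBump (t i) := fun i =>
    ⟨1 / (2 * (n + 1)), 1 / (n + 1), by positivity, by
      apply one_div_lt_one_div_of_lt hn; linarith⟩ with hb
  have hi : ∀ i : Fin n, (i : ℝ) + 1 ≤ n := fun i => by exact_mod_cast i.2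
  refine ⟨fun i => b i, t, fun i => (b i).contDiff, fun i s hs => ?_, fun i => ?_, fun i j => ?_⟩
  · apply (b i).zero_of_le_dist
    show 1 / ((n : ℝ) + 1) ≤ dist s (t i)
    by_contra hlt
    rw [not_le, Real.dist_eq, abs_lt] at hlt
    apply hs
    have h1 : 1 / ((n : ℝ) + 1) ≤ t i := by
      apply div_le_div_of_nonneg_right _ hn.le
      linarith [Nat.cast_nonneg (α := ℝ) (i : ℕ)]
    have h2 : t i + 1 / ((n : ℝ) + 1) ≤ 1 := by
      rw [ht, ← add_div, div_le_one hn]; linarith [hi i]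
    exact ⟨by linarith [hlt.1], by linarith [hlt.2]⟩
  · exact ⟨by positivity, by rw [ht, div_lt_one hn]; linarith [hi i]⟩
  · split_ifs with hij
    · subst hij
      apply (b i).one_of_mem_closedBall
      exact Metric.mem_closedBall_self (b i).rIn_pos.le
    · apply (b i).zero_of_le_dist
      show 1 / ((n : ℝ) + 1) ≤ dist (t j) (t i)
      rw [Real.dist_eq, ht, ← sub_div, abs_div, abs_of_pos hn]
      apply div_le_div_of_nonneg_right _ hn.le
      have h1 : (1 : ℤ) ≤ |(j : ℤ) - (i : ℤ)| := by
        apply Int.one_le_abs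
        intro h
        exact hij (Fin.ext (by omega))
      have h2 : (1 : ℝ) ≤ |(j : ℝ) - (i : ℝ)| := by exact_mod_cast h1
      simpa using h2

lemma hasDerivAt_line {E W : Type*} [NormedAddCommGroup E] [NormedSpace ℝ E]
    [NormedAddCommGroup W] [NormedSpace ℝ W] {T : E → W} {s : E}
    (hT : DifferentiableAt ℝ T s) (c : E) :
    HasDerivAt (fun τ : ℝ => T (s + τ • c)) (fderiv ℝ T s c) 0 := by
  have h1 : HasDerivAt (fun τ : ℝ => s + τ • c) c 0 := by
    simpa using ((hasDerivAt_id (0 : ℝ)).smul_const c).const_add s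
  have h2 : HasFDerivAt T (fderiv ℝ T s) (s + (0 : ℝ) • c) := by simpa using hT.hasFDerivAt
  exact h2.comp_hasDerivAt (0 : ℝ) h1

lemma hasDerivAt_clm_eval {V W : Type*} [NormedAddCommGroup V] [NormedSpace ℝ V]
    [NormedAddCommGroup W] [NormedSpace ℝ W] {T : ℝ → V →L[ℝ] W} {T' : V →L[ℝ] W} {t : ℝ}
    (hT : HasDerivAt T T' t) (u : V) : HasDerivAt (fun τ => T τ u) (T' u) t := by
  simpa using hT.clm_apply (hasDerivAt_const t u)

lemma hasDerivAt_eval_line {E V : Type*} [NormedAddCommGroup E] [NormedSpace ℝ E]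
    [NormedAddCommGroup V] [NormedSpace ℝ V] {T : E → V →L[ℝ] V →L[ℝ] ℝ} {s : E}
    (hT : DifferentiableAt ℝ T s) (c : E) (u w : V) :
    HasDerivAt (fun τ : ℝ => T (s + τ • c) u w) (fderiv ℝ T s c u w) 0 :=
  hasDerivAt_clm_eval (T := fun τ : ℝ => T (s + τ • c) u)
    (hasDerivAt_clm_eval (V := V) (W := V →L[ℝ] ℝ) (T := fun τ : ℝ => T (s + τ • c))
      (hasDerivAt_line (W := V →L[ℝ] V →L[ℝ] ℝ) (T := T) hT c) u) w

/-- The profile is the squashed combination of dual bumps. At the center t j it depends on the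
single parameter s j, through a map with positive derivative, so probing at t j detects both s j and
its variation. -/
theorem infiniteDimensional_zollMetrics {h κ : ℝ} (hκ : 0 < κ) (hh : κ < h) :
    InfiniteDimensional (zollMetrics h κ) (hillUnion h κ) := by
  intro n
  obtain ⟨W⟩ := nonempty_window hκ hh
  obtain ⟨φ, t, hφ, hφ0, ht, hφt⟩ := exists_dual_bumps n
  set Q : EuclideanSpace ℝ (Fin n) → ℝ → ℝ := fun s x => ∑ i, s i * φ i x with hQ
  have hQs : ContDiff ℝ ∞ fun z : EuclideanSpace ℝ (Fin n) × ℝ => Q z.1 z.2 := by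
    refine ContDiff.sum fun i _ => ContDiff.mul ?_ ((hφ i).comp contDiff_snd)
    exact (EuclideanSpace.proj i : EuclideanSpace ℝ (Fin n) →L[ℝ] ℝ).contDiff.comp contDiff_fst
  have hQ0 : ∀ e s, s ∉ Set.Ioo (0 : ℝ) 1 → Q e s = 0 := fun e s hs => by
    simp [hQ, hφ0 _ s hs]
  have hQt : ∀ e j, Q e (t j) = e j := fun e j => by simp [hQ, hφt]
  have hP : ∀ e, IsProfile fun s => squash (Q e s) := fun e =>
    isProfile_squash_comp (hQs.comp (contDiff_const.prodMk contDiff_id)) (hQ0 e)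
  have hsm : ContDiff ℝ ∞ fun z : EuclideanSpace ℝ (Fin n) × Plane =>
      (W.metric (hP z.1)).inner z.2 := by
    have hc := W.contDiff_coeff (P := fun e s => squash (Q e s)) (contDiff_squash.comp hQs)
      fun e => (hP e).zero
    refine contDiff_add_smul_smulRight planeInner
      (f := fun z : EuclideanSpace ℝ (Fin n) × Plane =>
        W.coeff (fun s => squash (Q z.1 s)) (‖z.2‖ ^ 2)) ?_ contDiff_snd
    exact ContDiff.comp
      (g := fun z : EuclideanSpace ℝ (Fin n) × ℝ => W.coeff (fun s => squash (Q z.1 s)) z.2)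
      (f := fun z : EuclideanSpace ℝ (Fin n) × Plane => (z.1, ‖z.2‖ ^ 2)) hc
      (contDiff_fst.prodMk ((contDiff_norm_sq ℝ).comp contDiff_snd))
  refine ⟨fun e => W.metric (hP e), fun e => W.metric_mem_zollMetrics (hP e), ?_, hsm, ?_⟩
  · intro e e' he
    have h1 := W.profile_eq_of_equivOn (hP e) (hP e') he
    ext j
    have h2 := squash_injective (congrFun h1 (t j))
    rwa [hQt, hQt] at h2
  · intro e c hc
    obtain ⟨j, hj⟩ : ∃ j, c j ≠ 0 := by
      by_contra hcon
      push Not at hcon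
      exact hc (by ext j; simpa using hcon j)
    refine ⟨polarPoint (W.probeRadius (t j)) 0, W.probe_mem_hillUnion (ht j), fun h0 => ?_⟩
    set x := polarPoint (W.probeRadius (t j)) 0 with hx
    have hd : DifferentiableAt ℝ (fun e => (W.metric (hP e)).inner x) e :=
      ((ContDiff.comp (g := fun z : EuclideanSpace ℝ (Fin n) × Plane =>
        (W.metric (hP z.1)).inner z.2) (f := fun e => (e, x)) hsm
        (contDiff_id.prodMk contDiff_const)).differentiable (by simp)) e
    have h1 := hasDerivAt_eval_line hd c x x
    rw [h0] at h1
    simp only [hx, W.metric_probe _ (ht j), hQt] at h1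
    have h2 : HasDerivAt (fun τ : ℝ => (e + τ • c) j) (c j) 0 := by
      simpa using ((hasDerivAt_id (0 : ℝ)).mul_const (c j)).const_add (e j)
    have h3 : HasDerivAt (fun τ : ℝ => squash ((e + τ • c) j)) _ 0 :=
      HasDerivAt.comp (h₂ := squash) (h := fun τ : ℝ => (e + τ • c) j) 0 (hasDerivAt_squash _) h2
    have h4 := (((h3.const_mul (W.sensitivity (t j))).const_add 1).pow 2).const_mul
      (W.probeRadius (t j) ^ 2)
    -- The direct derivative of the probed value is a product of c j with nonzero factors, while a
    -- vanishing derivative of the metric would make it 0.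
    have h5 := h4.unique h1
    have hs := W.sensitivity_pos (ht j)
    have hr := W.probeRadius_pos (ht j)
    have hA := W.one_add_sensitivity_pos (hP e) (ht j)
    have hq : 0 < √(1 + e j ^ 2) := Real.sqrt_pos.2 (by positivity)
    rw [hQt] at hA
    have hz : (0 : Plane →L[ℝ] Plane →L[ℝ] ℝ) (polarPoint (W.probeRadius (t j)) 0)
      (polarPoint (W.probeRadius (t j)) 0) = 0 := rfl
    have hz1 : (1 : ℝ) + e j ^ 2 ≠ 0 := by positivity
    simp [hs.ne', hr.ne', hA.ne', hj, hq.ne', hz1] at h5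

theorem exists_embedding {h κ : ℝ} (hκ : 0 < κ) (hh : κ < h) :
    ∃ a b δ : ℝ, -(h / κ - 1) ≤ a ∧ a < b ∧ b ≤ 0 ∧ 0 < δ ∧
      ∃ Φ : BumpSpace → RotMetric,
        (∀ f, Φ f ∈ zollMetrics h κ) ∧
        (∀ f f', EquivOn (hillUnion h κ) (Φ f) (Φ f') → f = f') ∧
        ∀ f, ∃ F : ℝ → ℝ, ContDiff ℝ (⊤ : ℕ∞) F ∧
          ReflectionLaws (h / κ - 1) F ∧
          (∀ s ∈ Set.Ioo (0 : ℝ) 1,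
            F (a + (b - a) * s) = δ * (f s / Real.sqrt (1 + f s ^ 2))) ∧
          (∀ x ∈ Set.Icc (-(h / κ - 1)) 0, x ∉ Set.Ioo a b → F x = 0) ∧
          HasDeformationFunction h κ (Φ f) F := by
  obtain ⟨W⟩ := nonempty_window hκ hh
  have hP : ∀ f : BumpSpace, IsProfile fun s => squash (f s) := fun f =>
    isProfile_squash_comp f.contDiff fun s hs =>
      image_eq_zero_of_notMem_tsupport fun hm => hs (f.tsupport_subset hm)
  have hd : 0 < W.γ - W.α := sub_pos.2 W.α_lt
  -- The window lives in the variable -x, so negation exchanges its endpoints.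
  refine ⟨-W.γ, -W.α, W.size, by linarith [W.γ_lt], by linarith, by linarith [W.α_pos],
    W.size_pos, fun f => W.metric (hP f), fun f => W.metric_mem_zollMetrics (hP f), ?_, ?_⟩
  · intro f f' he
    have h1 := W.profile_eq_of_equivOn (hP f) (hP f') he
    exact TestFunction.ext fun s => squash_injective (congrFun h1 s)
  · intro f
    refine ⟨fun x => (1 - x ^ 2) * W.oddPart (fun s => squash (f s)) x,
      (contDiff_const.sub (contDiff_id.pow 2)).mul (W.contDiff_oddPart_single (hP f)),
      W.reflectionLaws _, ?_, ?_, W.hasDeformationFunction (hP f)⟩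
    · intro s hs
      have hm := W.probe_mem hs
      have e1 : -W.γ + (-W.α - -W.γ) * s = -W.γ + (W.γ - W.α) * s := by ring
      have e2 : (-W.γ + (W.γ - W.α) * s + W.γ) / (W.γ - W.α) = s := by field_simp; ring
      simp only [e1]
      rw [W.oddPart_of_mem (hP f).zero ⟨by linarith [hm.1, W.γ_lt], by linarith [hm.2, W.α_pos]⟩,
        e2, squash]
    · intro x hx hxn
      have h1 := W.rescale_notMem (y := -x) fun hm => hxn ⟨by linarith [hm.2], by linarith [hm.1]⟩
      rw [sub_neg_eq_add, add_comm] at h1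
      simp only
      rw [W.oddPart_of_mem (hP f).zero hx, (hP f).zero _ h1, mul_zero]

end Kepler

end

/-- First part: infinite dimensionality. Second part: the space of smooth functions with compact
support in `(0, 1)` embeds, a function `f` being sent to the metric whose deformation function
`F` is obtained by rescaling `f` to a subinterval of `[-ξ, 0]` and extending by the reflection
laws. The factor `1 / √(1 + f²)` keeps the size of the rescaled function below `δ`, as is needed
for a Riemannian metric. -/
theorem theorem3 (h κ : ℝ) (hκ : 0 < κ) (hh : κ < h) :
    Kepler.InfiniteDimensional (Kepler.zollMetrics h κ) (Kepler.hillUnion h κ) ∧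
    ∃ a b δ : ℝ, -(h / κ - 1) ≤ a ∧ a < b ∧ b ≤ 0 ∧ 0 < δ ∧
      ∃ Φ : Kepler.BumpSpace → Kepler.RotMetric,
        (∀ f, Φ f ∈ Kepler.zollMetrics h κ) ∧
        (∀ f f', Kepler.EquivOn (Kepler.hillUnion h κ) (Φ f) (Φ f') → f = f') ∧
        ∀ f, ∃ F : ℝ → ℝ, ContDiff ℝ (⊤ : ℕ∞) F ∧
          Kepler.ReflectionLaws (h / κ - 1) F ∧
          (∀ s ∈ Set.Ioo (0 : ℝ) 1,
            F (a + (b - a) * s) = δ * (f s / Real.sqrt (1 + f s ^ 2))) ∧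
          (∀ x ∈ Set.Icc (-(h / κ - 1)) 0, x ∉ Set.Ioo a b → F x = 0) ∧
          Kepler.HasDeformationFunction h κ (Φ f) F :=
  ⟨Kepler.infiniteDimensional_zollMetrics hκ hh, Kepler.exists_embedding hκ hh⟩
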